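/- Let $B$ be a finite alphabet with the discrete topology, and let $X\subseteq B^{\mathbb Z}$ be a subshift (a closed set invariant under all powers of the shift $\sigma$, $(\sigma x)_i=x_{i+1}$). Assume that $X$ is sofic, i.e. $X$ is the set of label sequences of bi-infinite walks in some finite directed graph with edges labeled by $B$, and that its entropy $h(X)=\lim_{n\to\infty}\frac1n\log|B_n(X)|$ is positive, where $B_n(X)$ is the set of words of length $n$ occurring in points of $X$ (so $X \neq \emptyset$). Let $A$ be any finite alphabet. Then there is an injective group homomorphism from the veelike group of $A^*$ into the mapping class group $\mathrm{MCG}(X)$. Here the *veelike group of $A^*$* is the group (under composition) of all bijections $g:A^*\to A^*$ for which there is $n\in\mathbb N$ such that for every $u\in A^*$ with $|u|=n$ there is $u'\in A^*$ with $g(uv)=u'v$ for all $v\in A^*$. The *mapping torus* $\mathbf SX$ is the quotient space of $X\times\mathbb R$ by the relation $(x,t)\cong(\sigma^n(x),t-n)$, $n\in\mathbb Z$, with the $\mathbb R$-flow $r+[x,t]=[x,t+r]$. Let $\mathcal F(X)$ be the group of self-homeomorphisms $f$ of $\mathbf SX$ that preserve the natural orientation of each orbit, i.e. for every $y\in\mathbf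 SX$ there is an increasing bijection $\varphi:\mathbb R\to\mathbb R$ with $f(t+y)=\varphi(t)+f(y)$ for all $t\in\mathbb R$. Elements $f,g\in\mathcal F(X)$ are *isotopic* if there is a continuous map $h:[0,1]\times\mathbf SX\to\mathbf SX$ with $h(0,\cdot)=f$, $h(1,\cdot)=g$ and $h(t,\cdot)\in\mathcal F(X)$ for all $t\in[0,1]$. The *mapping class group* $\mathrm{MCG}(X)$ is the quotient of $\mathcal F(X)$ by isotopy. -/

import Mathlib

open SymbolicDynamics.FullShift

namespace SymbolicMCG

section Words

variable {B : Type*} [TopologicalSpace B]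

/-- The set `B_n(X)` of words of length `n` that occur in some point of the subshift `X`. -/
def wordsOfLength (X : Subshift B ℤ) (n : ℕ) : Set (Fin n → B) :=
  {w | ∃ x ∈ X.carrier, ∃ i : ℤ, ∀ j : Fin n, w j = x (i + (j : ℤ))}

/-- The entropy `h(X) = lim (1/n) log |B_n(X)|` of a subshift over a finite alphabet (the limit
exists by subadditivity, and the sequence is bounded). The empty subshift gets the value `0`,
so that it does not have positive entropy. -/
noncomputable def entropy (X : Subshift B ℤ) : ℝ :=
  Filter.limsup (fun n : ℕ => Real.log ((wordsOfLength X n).ncard : ℝ) / (n : ℝ)) Filter.atTop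

/-- A subshift is sofic if it is presented by a finite labeled directed graph: the states are
`Fin k`, `E` is the set of labeled edges, and the points of `X` are exactly the label
sequences of the bi-infinite walks. -/
def IsSofic (X : Subshift B ℤ) : Prop :=
  ∃ (k : ℕ) (E : Set (Fin k × B × Fin k)),
    X.carrier = {x | ∃ q : ℤ → Fin k, ∀ i : ℤ, (q i, x i, q (i + 1)) ∈ E}

end Words

section Torus

variable {B : Type*} [TopologicalSpace B]

/-- The relation `(x, t) ≅ (σⁿ x, t - n)` on `X × ℝ`, where `(σⁿ x) i = x (n + i)`. -/
def torusSetoid (X : Subshift B ℤ) : Setoid (X.carrier × ℝ) where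
  r p q := ∃ n : ℤ, (q.1 : ℤ → B) = shift n (p.1 : ℤ → B) ∧ q.2 = p.2 - (n : ℝ)
  iseqv :=
    { refl := fun p => ⟨0, by simp, by simp⟩
      symm := by
        rintro p q ⟨n, h1, h2⟩
        refine ⟨-n, ?_, ?_⟩
        · rw [h1, ← shift_add]; simp
        · rw [h2]; push_cast; ring
      trans := by
        rintro p q r ⟨n, h1, h2⟩ ⟨m, h3, h4⟩
        refine ⟨n + m, ?_, ?_⟩
        · rw [h3, h1, ← shift_add]
        · rw [h4, h2]; push_cast; ring }

/-- The mapping torus `SX`. -/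
def MappingTorus (X : Subshift B ℤ) : Type _ := Quotient (torusSetoid X)

/-- The quotient topology. -/
instance (X : Subshift B ℤ) : TopologicalSpace (MappingTorus X) :=
  inferInstanceAs (TopologicalSpace (Quotient (torusSetoid X)))

/-- The flow `r + [x, t] = [x, t + r]`. -/
def MappingTorus.flow {X : Subshift B ℤ} (r : ℝ) : MappingTorus X → MappingTorus X :=
  Quotient.map (fun p => (p.1, p.2 + r)) (by
    rintro p q ⟨n, h1, h2⟩
    exact ⟨n, h1, by simp only [h2]; ring⟩)

/-- A self-map of the mapping torus preserves the orientation of every orbit if on each orbit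
it is given by an increasing bijection of the time parameter. -/
def OrientationPreserving {X : Subshift B ℤ} (f : MappingTorus X → MappingTorus X) : Prop :=
  ∀ y : MappingTorus X, ∃ φ : ℝ ≃o ℝ, ∀ t : ℝ,
    f (MappingTorus.flow t y) = MappingTorus.flow (φ t) (f y)

/-- The group `F(X)` of the self-homeomorphisms of the mapping torus that preserve the natural
orientation of each orbit. -/
def flowGroup (X : Subshift B ℤ) : Subgroup (MappingTorus X ≃ₜ MappingTorus X) where
  carrier := {f | OrientationPreserving f}
  one_mem' := fun y => ⟨OrderIso.refl ℝ, fun t => rfl⟩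
  mul_mem' := by
    intro f g hf hg y
    obtain ⟨ψ, hψ⟩ := hg y
    obtain ⟨φ, hφ⟩ := hf (g y)
    refine ⟨ψ.trans φ, fun t => ?_⟩
    change f (g _) = MappingTorus.flow (φ (ψ t)) (f (g y))
    rw [hψ, hφ]
  inv_mem' := by
    intro f hf y
    obtain ⟨φ, hφ⟩ := hf (f.symm y)
    refine ⟨φ.symm, fun t => ?_⟩
    change f.symm _ = MappingTorus.flow (φ.symm t) (f.symm y)
    rw [Homeomorph.symm_apply_eq, hφ]
    simp

/-- Two elements of `F(X)` are isotopic if they are joined by a jointly continuous path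
of elements of `F(X)`, indexed by `[0, 1]`. -/
def Isotopic {X : Subshift B ℤ} (f g : flowGroup X) : Prop :=
  ∃ h : unitInterval × MappingTorus X → MappingTorus X, Continuous h ∧
    (∀ x, h (0, x) = f.1 x) ∧ (∀ x, h (1, x) = g.1 x) ∧
    ∀ t : unitInterval, ∃ k : flowGroup X, ∀ x, h (t, x) = k.1 x

/-- Isotopy is a congruence on `F(X)`. -/
def isotopyCon (X : Subshift B ℤ) : Con (flowGroup X) where
  r := Isotopic
  iseqv :=
    { refl := fun f => ⟨fun p => f.1 p.2, f.1.continuous.comp continuous_snd,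
        fun _ => rfl, fun _ => rfl, fun _ => ⟨f, fun _ => rfl⟩⟩
      symm := by
        rintro f g ⟨h, hc, h0, h1, hk⟩
        refine ⟨fun p => h (unitInterval.symm p.1, p.2), by fun_prop, ?_, ?_, ?_⟩
        · intro x; simp [h1]
        · intro x; simp [h0]
        · intro t; exact hk (unitInterval.symm t)
      trans := by
        rintro f g k ⟨h, hc, h0, h1, hk⟩ ⟨h', hc', h0', h1', hk'⟩
        have hg : Continuous g.1.symm := g.1.symm.continuous
        refine ⟨fun p => h (p.1, g.1.symm (h' p)), by fun_prop, ?_, ?_, ?_⟩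
        · intro x; simp [h0, h0']
        · intro x; simp [h1, h1']
        · intro t
          obtain ⟨a, ha⟩ := hk t
          obtain ⟨b, hb⟩ := hk' t
          exact ⟨a * (g⁻¹ * b), fun x => by simp only [ha, hb]; rfl⟩ }
  mul' := by
    rintro f g f' g' ⟨h, hc, h0, h1, hk⟩ ⟨h', hc', h0', h1', hk'⟩
    refine ⟨fun p => h (p.1, h' p), by fun_prop, ?_, ?_, ?_⟩
    · intro x; simp only [h0', h0]; rfl
    · intro x; simp only [h1', h1]; rfl
    · intro t
      obtain ⟨a, ha⟩ := hk t
      obtain ⟨b, hb⟩ := hk' t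
      exact ⟨a * b, fun x => by simp only [ha, hb]; rfl⟩

/-- The mapping class group of a subshift: the quotient of the group `F(X)` under isotopy. -/
abbrev MCG (X : Subshift B ℤ) : Type _ := (isotopyCon X).Quotient

end Torus

section Veelike

/-- A self-map `g` of `A*` is veelike if for some `n` it acts on the words of length at least `n`
by a local rule on the prefix of length `n`. -/
def IsVeelike {A : Type*} (g : List A → List A) : Prop :=
  ∃ n : ℕ, ∀ u : List A, u.length = n → ∃ u' : List A, ∀ v : List A, g (u ++ v) = u' ++ v

/-- The local rule extends to all words that are long enough. -/
theorem isVeelike_iff {A : Type*} (g : List A → List A) :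
    IsVeelike g ↔ ∃ n : ℕ, ∀ u : List A, n ≤ u.length → ∀ v, g (u ++ v) = g u ++ v := by
  constructor
  · rintro ⟨n, h⟩
    refine ⟨n, fun u hu v => ?_⟩
    obtain ⟨u', hu'⟩ := h (u.take n) (by simpa using hu)
    have h1 := hu' (u.drop n)
    have h2 := hu' (u.drop n ++ v)
    rw [← List.append_assoc, List.take_append_drop] at h2
    rw [List.take_append_drop] at h1
    rw [h1, h2, List.append_assoc]
  · rintro ⟨n, h⟩
    exact ⟨n, fun u hu => ⟨g u, fun v => h u hu.ge v⟩⟩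

/-- The veelike group of `A*`. -/
def veelikeGroup (A : Type*) [Finite A] : Subgroup (Equiv.Perm (List A)) where
  carrier := {g | IsVeelike g}
  one_mem' := ⟨0, fun u _ => ⟨u, fun _ => rfl⟩⟩
  mul_mem' := by
    intro f g hf hg
    obtain ⟨n, hn⟩ := (isVeelike_iff _).1 hf
    obtain ⟨m, hm⟩ := (isVeelike_iff _).1 hg
    refine (isVeelike_iff _).2 ⟨m + n, fun u hu v => ?_⟩
    change f (g (u ++ v)) = f (g u) ++ v
    rw [hm u (by omega), hn]
    have h1 := hm (u.take m) (by simp; omega) (u.drop m)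
    rw [List.take_append_drop] at h1
    rw [h1]
    simp
    omega
  inv_mem' := by
    intro g hg
    obtain ⟨n, hn⟩ := (isVeelike_iff _).1 hg
    have hfin : {u : List A | u.length < n}.Finite := List.finite_length_lt A n
    obtain ⟨M, hM⟩ := (hfin.image fun u => (g u).length).bddAbove
    refine (isVeelike_iff _).2 ⟨M + 1, fun w hw v => ?_⟩
    change g.symm _ = g.symm w ++ v
    rw [Equiv.symm_apply_eq, hn, Equiv.apply_symm_apply]
    by_contra hlt
    have := hM ⟨g.symm w, not_le.1 hlt, rfl⟩
    simp at this
    omega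

end Veelike

end SymbolicMCG

/-! Positive entropy yields a state of the graph with two different loop labels of equal length;
otherwise the number of words would grow polynomially (`card_innerLabels_le`). By pigeonhole and
passing to powers one obtains words u ≠ v of equal length that define the same idempotent relation
on states. Nonempty products of u and v can then be exchanged for one another inside points of X
(`sameRel_binary`, `Coding.Stable`). Letters of A are coded by products ending in the block uv, and
the marker is u^(r+4)uv. A marker that ends after another one can meet the code read after that one,
preceded by its block, only in the final block (`separated_of_reads`).

A veelike g acts as follows: after each marker read the longest coded word w with at most n letters,
and replace its code by that of g w. This changes lengths, so it is not a map of X, but after a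
change of time it is a map of the mapping torus. Points are presented by parses, sequences of
letters and labels; the substitutions `C.img id` and `C.img g` turn a parse into the point and into
its image. The replacement neither creates nor destroys markers (`Coding.Marked.change`), so the
image can be parsed again (`Coding.trunc_mem_parses`), and a parse is unique up to the shift
(`Coding.parses_unique`), so the map is well defined.

Composites of such maps realize products (`ImplementsAt.comp`). A map realizing the identity moves
points along their orbits by a continuous displacement, and scaling the displacement is an isotopy
to the identity (`ImplementsAt.isotopic_one`). Hence the class of a realization of g depends only on
g, and multiplicatively so.

For injectivity, paths in the torus stay in one orbit, since X is totally disconnected; a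
homeomorphism isotopic to the identity thus preserves every orbit. The periodic point repeating the
marker and the code of w is sent to the orbit of the one for g w, and unique parsing forces g w = w
(`Implements.eq_one`). -/

namespace SymbolicMCG

/-! ### Words read at a position -/

section Reads

variable {α β : Type*}

/-- The sequence `x` reads the word `w` from position `p` on. -/
def Reads (x : ℤ → α) : ℤ → List α → Prop
  | _, [] => True
  | p, a :: w => x p = a ∧ Reads x (p + 1) w

@[simp] theorem reads_nil (x : ℤ → α) (p : ℤ) : Reads x p [] := trivial

@[simp] theorem reads_cons (x : ℤ → α) (p : ℤ) (a : α) (w : List α) :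
    Reads x p (a :: w) ↔ x p = a ∧ Reads x (p + 1) w := Iff.rfl

theorem reads_append (x : ℤ → α) (p : ℤ) (v w : List α) :
    Reads x p (v ++ w) ↔ Reads x p v ∧ Reads x (p + v.length) w := by
  induction v generalizing p with
  | nil => simp
  | cons a v ih =>
    simp only [List.cons_append, reads_cons, ih, List.length_cons, and_assoc]
    have : p + 1 + (v.length : ℤ) = p + ((v.length + 1 : ℕ) : ℤ) := by push_cast; ring
    rw [this]

theorem Reads.getElem {x : ℤ → α} {p : ℤ} {w : List α} (h : Reads x p w) (k : ℕ)
    (hk : k < w.length) : x (p + k) = w[k] := by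
  induction w generalizing p k with
  | nil => simp at hk
  | cons a w ih =>
    cases k with
    | zero => simpa using h.1
    | succ k =>
      have := ih h.2 k (by simpa using hk)
      simp only [List.getElem_cons_succ, ← this]
      congr 1; push_cast; ring

theorem reads_of_getElem {x : ℤ → α} {p : ℤ} {w : List α}
    (h : ∀ (k : ℕ) (hk : k < w.length), x (p + k) = w[k]) : Reads x p w := by
  induction w generalizing p with
  | nil => trivial
  | cons a w ih =>
    refine ⟨by have := h 0 (by simp); simpa only [Nat.cast_zero, add_zero, List.getElem_cons_zero] using this, ih fun k hk => ?_⟩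
    have := h (k + 1) (by simpa using hk)
    simp only [List.getElem_cons_succ] at this
    rw [← this]; congr 1; push_cast; ring

theorem Reads.unique {x : ℤ → α} {p : ℤ} {v w : List α} (hv : Reads x p v) (hw : Reads x p w)
    (h : v.length = w.length) : v = w :=
  List.ext_getElem h fun k h1 h2 => by rw [← hv.getElem k h1, ← hw.getElem k h2]

theorem Reads.congr {x y : ℤ → α} {p q : ℤ} {w : List α} (h : Reads x p w)
    (hxy : ∀ k : ℕ, k < w.length → y (q + k) = x (p + k)) : Reads y q w :=
  reads_of_getElem fun k hk => by rw [hxy k hk, h.getElem k hk]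

theorem reads_shift (x : ℤ → α) (m p : ℤ) (w : List α) :
    Reads (shift m x) p w ↔ Reads x (m + p) w := by
  induction w generalizing p with
  | nil => simp
  | cons a w ih => simp [ih, add_assoc]

theorem reads_ofFn (x : ℤ → α) (p : ℤ) (n : ℕ) :
    Reads x p (List.ofFn fun j : Fin n => x (p + (j : ℤ))) :=
  reads_of_getElem fun k hk => by simp

end Reads

/-! ### Block boundaries as increasing integer sequences -/

section Positions

/-- The starting positions of the blocks of a bi-infinite concatenation with block lengths `l`. -/
noncomputable def pos (l : ℤ → ℕ) (i : ℤ) : ℤ :=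
  ∑ j ∈ Finset.Ico 0 i, (l j : ℤ) - ∑ j ∈ Finset.Ico i 0, (l j : ℤ)

@[simp] theorem pos_zero (l : ℤ → ℕ) : pos l 0 = 0 := by simp [pos]

theorem pos_succ (l : ℤ → ℕ) (i : ℤ) : pos l (i + 1) = pos l i + l i := by
  unfold pos
  rcases le_or_gt 0 i with h | h
  · have h1 : Finset.Ico 0 (i + 1) = insert i (Finset.Ico 0 i) := by
      ext j; simp only [Finset.mem_Ico, Finset.mem_insert]; omega
    have h2 : Finset.Ico (i + 1) 0 = ∅ := by ext j; simp; omega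
    have h3 : Finset.Ico i 0 = ∅ := by ext j; simp; omega
    rw [h1, h2, h3, Finset.sum_insert (by simp)]; simp; ring
  · have h1 : Finset.Ico i 0 = insert i (Finset.Ico (i + 1) 0) := by
      ext j; simp only [Finset.mem_Ico, Finset.mem_insert]; omega
    have h2 : Finset.Ico 0 (i + 1) = ∅ := by ext j; simp; omega
    have h3 : Finset.Ico 0 i = ∅ := by ext j; simp; omega
    rw [h1, h2, h3, Finset.sum_insert (by simp)]; simp

theorem eq_of_succ_sub {Q Q' : ℤ → ℤ} (h0 : Q 0 = Q' 0)
    (h : ∀ i, Q (i + 1) - Q i = Q' (i + 1) - Q' i) (i : ℤ) : Q i = Q' i := by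
  induction i using Int.induction_on with
  | zero => exact h0
  | succ i ih => have := h i; omega
  | pred i ih => have := h (-i - 1); simp only [sub_add_cancel] at this; omega

theorem eq_pos {l : ℤ → ℕ} {Q : ℤ → ℤ} (h0 : Q 0 = 0) (h : ∀ i, Q (i + 1) = Q i + l i) (i : ℤ) :
    Q i = pos l i :=
  eq_of_succ_sub (by simp [h0]) (fun i => by rw [h, pos_succ]; ring) i

theorem pos_shift (l : ℤ → ℕ) (m i : ℤ) :
    pos (fun j => l (m + j)) i = pos l (m + i) - pos l m := by
  refine (eq_pos (Q := fun i => pos l (m + i) - pos l m) (by simp) (fun i => ?_) i).symm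
  rw [← add_assoc, pos_succ]; ring

theorem pos_add_const {l : ℤ → ℕ} {i : ℤ} {n : ℕ} (h : ∀ j : ℕ, j < n → l (i + j) = 1) :
    pos l (i + n) = pos l i + n := by
  induction n with
  | zero => simp
  | succ n ih =>
    have := ih fun j hj => h j (by omega)
    push_cast
    rw [← add_assoc, pos_succ, this, h n (by omega)]; push_cast; ring

theorem strictMono_pos {l : ℤ → ℕ} (hl : ∀ i, 0 < l i) : StrictMono (pos l) :=
  strictMono_int_of_lt_succ fun i => by rw [pos_succ]; have := hl i; omega

theorem le_sub_of_strictMono {Q : ℤ → ℤ} (hQ : StrictMono Q) {i j : ℤ} (h : i ≤ j) :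
    j - i ≤ Q j - Q i := by
  obtain ⟨n, rfl⟩ := Int.le.dest h
  clear h
  induction n with
  | zero => simp
  | succ n ih =>
    have := hQ (show i + n < i + (n + 1 : ℕ) by push_cast; omega)
    push_cast at *
    omega

/-- A strictly increasing integer sequence grows at least linearly in both directions, so there is a
greatest index with `Q i ≤ j`. -/
theorem exists_block {Q : ℤ → ℤ} (hQ : StrictMono Q) (j : ℤ) :
    ∃ i, Q i ≤ j ∧ j < Q (i + 1) := by
  obtain ⟨i, hi, hmax⟩ := Int.exists_greatest_of_bdd (P := fun i => Q i ≤ j)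
    ⟨max 0 (j - Q 0), fun z hz => by
      rcases le_total 0 z with h | h
      · have := le_sub_of_strictMono hQ h; omega
      · omega⟩
    ⟨min 0 (j - Q 0), by
      have := le_sub_of_strictMono hQ (min_le_left 0 (j - Q 0)); omega⟩
  refine ⟨i, hi, ?_⟩
  by_contra hlt
  have := hmax (i + 1) (by omega)
  omega

/-- The other half-open convention, needed because the end of a marker belongs to the block that it
closes. -/
theorem exists_block' {Q : ℤ → ℤ} (hQ : StrictMono Q) (j : ℤ) :
    ∃ i, Q i < j ∧ j ≤ Q (i + 1) := by
  obtain ⟨i, h1, h2⟩ := exists_block hQ (j - 1)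
  exact ⟨i, by omega, by omega⟩

theorem block_unique {Q : ℤ → ℤ} (hQ : StrictMono Q) {i i' j : ℤ} (h1 : Q i ≤ j)
    (h2 : j < Q (i + 1)) (h1' : Q i' ≤ j) (h2' : j < Q (i' + 1)) : i = i' := by
  have h3 := hQ.lt_iff_lt.1 (h1.trans_lt h2')
  have h4 := hQ.lt_iff_lt.1 (h1'.trans_lt h2)
  omega

/-- A strictly increasing bi-infinite sequence is determined by its range and one value. -/
theorem eq_of_range_eq {Q Q' : ℤ → ℤ} (hQ : StrictMono Q) (hQ' : StrictMono Q')
    (h : Set.range Q = Set.range Q') (h0 : Q 0 = Q' 0) : Q = Q' := by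
  -- The value after `Q i` is the least element of the common range above it, hence at most the next
  -- value of `Q'`; similarly below.
  have key : ∀ {Q Q' : ℤ → ℤ}, StrictMono Q → StrictMono Q' → Set.range Q = Set.range Q' →
      ∀ i, Q i = Q' i → Q (i + 1) ≤ Q' (i + 1) ∧ Q' (i - 1) ≤ Q (i - 1) := by
    intro Q Q' hQ hQ' h i hi
    constructor
    · obtain ⟨j, hj⟩ : Q' (i + 1) ∈ Set.range Q := h ▸ ⟨_, rfl⟩
      have : i < j := hQ.lt_iff_lt.1 (by rw [hj, hi]; exact hQ' (by omega))
      rw [← hj]; exact hQ.monotone (by omega)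
    · obtain ⟨j, hj⟩ : Q' (i - 1) ∈ Set.range Q := h ▸ ⟨_, rfl⟩
      have : j < i := hQ.lt_iff_lt.1 (by rw [hj, hi]; exact hQ' (by omega))
      rw [← hj]; exact hQ.monotone (by omega)
  funext i
  induction i using Int.induction_on with
  | zero => exact h0
  | succ i ih => exact le_antisymm (key hQ hQ' h i ih).1 (key hQ' hQ h.symm i ih.symm).1
  | pred i ih => exact le_antisymm (key hQ' hQ h.symm _ ih.symm).2 (key hQ hQ' h _ ih).2

/-- A set of integers that is unbounded in both directions can be enumerated increasingly. -/
theorem exists_strictMono_range {K : Set ℤ} (h1 : ∀ j, ∃ k ∈ K, j ≤ k) (h2 : ∀ j, ∃ k ∈ K, k ≤ j) :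
    ∃ Q : ℤ → ℤ, StrictMono Q ∧ Set.range Q = K := by
  classical
  let : LocallyFiniteOrder K := LocallyFiniteOrder.ofFiniteIcc fun a b =>
      Set.Finite.of_finite_image (f := Subtype.val) ((Set.finite_Icc a.1 b.1).subset (by
        rintro _ ⟨c, hc, rfl⟩; exact hc)) Subtype.val_injective.injOn
  let : SuccOrder K := LinearLocallyFiniteOrder.succOrder K
  let : PredOrder K := LinearLocallyFiniteOrder.predOrder K
  have : IsSuccArchimedean K := inferInstance
  have : NoMaxOrder K := ⟨fun a => by
    obtain ⟨k, hk, h⟩ := h1 (a.1 + 1)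
    exact ⟨⟨k, hk⟩, show a.1 < k by omega⟩⟩
  have : NoMinOrder K := ⟨fun a => by
    obtain ⟨k, hk, h⟩ := h2 (a.1 - 1)
    exact ⟨⟨k, hk⟩, show k < a.1 by omega⟩⟩
  have : Nonempty K := by obtain ⟨k, hk, -⟩ := h1 0; exact ⟨⟨k, hk⟩⟩
  let e : K ≃o ℤ := orderIsoIntOfLinearSuccPredArch
  refine ⟨fun i => (e.symm i).1, fun i j h => e.symm.strictMono h, ?_⟩
  ext k
  constructor
  · rintro ⟨i, rfl⟩; exact (e.symm i).2
  · intro hk; exact ⟨e ⟨k, hk⟩, by simp⟩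

end Positions

/-! ### Bi-infinite concatenations and substitutions -/

section Concatenation

variable {α β γ : Type*}

/-- Nonempty words. -/
abbrev NeWord (α : Type*) := {w : List α // w ≠ []}

theorem NeWord.length_pos (w : NeWord α) : 0 < w.1.length := List.length_pos_of_ne_nil w.2

/-- The starting positions of the blocks of a bi-infinite concatenation. -/
noncomputable abbrev bpos (b : ℤ → NeWord α) : ℤ → ℤ := pos fun i => (b i).1.length

@[simp] theorem bpos_zero (b : ℤ → NeWord α) : bpos b 0 = 0 := pos_zero _

theorem bpos_succ (b : ℤ → NeWord α) (i : ℤ) : bpos b (i + 1) = bpos b i + (b i).1.length :=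
  pos_succ _ _

theorem strictMono_bpos (b : ℤ → NeWord α) : StrictMono (bpos b) :=
  strictMono_pos fun i => (b i).length_pos

/-- The concatenation of a bi-infinite sequence of nonempty words. -/
noncomputable def conc (b : ℤ → NeWord α) (j : ℤ) : α :=
  (b (exists_block (strictMono_bpos b) j).choose).1[(j - bpos b
    (exists_block (strictMono_bpos b) j).choose).toNat]'(by
      obtain ⟨h1, h2⟩ := (exists_block (strictMono_bpos b) j).choose_spec
      rw [bpos_succ] at h2
      omega)

theorem conc_apply (b : ℤ → NeWord α) (i : ℤ) (k : ℕ) (hk : k < (b i).1.length) :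
    conc b (bpos b i + k) = (b i).1[k] := by
  have hs := (exists_block (strictMono_bpos b) (bpos b i + k)).choose_spec
  have he : (exists_block (strictMono_bpos b) (bpos b i + k)).choose = i :=
    block_unique (strictMono_bpos b) hs.1 hs.2 (by omega) (by rw [bpos_succ]; omega)
  unfold conc
  congr 1
  · rw [he]
  · rw [he]; omega

theorem reads_conc (b : ℤ → NeWord α) (i : ℤ) : Reads (conc b) (bpos b i) (b i).1 :=
  reads_of_getElem fun k hk => conc_apply b i k hk

theorem eq_conc {b : ℤ → NeWord α} {x : ℤ → α} (h : ∀ i, Reads x (bpos b i) (b i).1) :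
    x = conc b := by
  funext j
  obtain ⟨i, h1, h2⟩ := exists_block (strictMono_bpos b) j
  rw [bpos_succ] at h2
  obtain ⟨k, rfl⟩ := Int.le.dest h1
  rw [conc_apply b i k (by omega), (h i).getElem k (by omega)]

theorem shift_conc (b : ℤ → NeWord α) (m : ℤ) :
    shift (bpos b m) (conc b) = conc fun i => b (m + i) := by
  refine eq_conc fun i => ?_
  rw [reads_shift]
  have := pos_shift (fun i => (b i).1.length) m i
  simp only [bpos] at *
  rw [this]
  convert reads_conc b (m + i) using 1
  simp

/-- The action of a nonerasing substitution on bi-infinite sequences. -/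
noncomputable def subst (φ : α → NeWord β) (x : ℤ → α) : ℤ → β := conc fun i => φ (x i)

/-- The position in `subst φ x` of the image of the symbol `x i`. -/
noncomputable abbrev spos (φ : α → NeWord β) (x : ℤ → α) : ℤ → ℤ := bpos fun i => φ (x i)

@[simp] theorem spos_zero (φ : α → NeWord β) (x : ℤ → α) : spos φ x 0 = 0 := pos_zero _

theorem spos_succ (φ : α → NeWord β) (x : ℤ → α) (i : ℤ) :
    spos φ x (i + 1) = spos φ x i + (φ (x i)).1.length := pos_succ _ _

theorem strictMono_spos (φ : α → NeWord β) (x : ℤ → α) : StrictMono (spos φ x) :=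
  strictMono_bpos _

theorem reads_subst (φ : α → NeWord β) (x : ℤ → α) (i : ℤ) :
    Reads (subst φ x) (spos φ x i) (φ (x i)).1 := reads_conc _ i

theorem eq_subst {φ : α → NeWord β} {x : ℤ → α} {y : ℤ → β}
    (h : ∀ i, Reads y (spos φ x i) (φ (x i)).1) : y = subst φ x := eq_conc h

theorem subst_shift (φ : α → NeWord β) (x : ℤ → α) (m : ℤ) :
    subst φ (shift m x) = shift (spos φ x m) (subst φ x) :=
  (shift_conc (fun i => φ (x i)) m).symm

theorem spos_shift (φ : α → NeWord β) (x : ℤ → α) (m i : ℤ) :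
    spos φ (shift m x) i = spos φ x (m + i) - spos φ x m :=
  pos_shift (fun i => (φ (x i)).1.length) m i

theorem Reads.subst (φ : α → NeWord β) {x : ℤ → α} {p : ℤ} {w : List α} (h : Reads x p w) :
    Reads (subst φ x) (spos φ x p) (w.flatMap fun a => (φ a).1) ∧
      spos φ x (p + w.length) = spos φ x p + (w.flatMap fun a => (φ a).1).length := by
  induction w generalizing p with
  | nil => simp
  | cons a w ih =>
    obtain ⟨rfl, h⟩ := h
    obtain ⟨h1, h2⟩ := ih h
    rw [spos_succ] at h1 h2
    rw [List.flatMap_cons, reads_append]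
    refine ⟨⟨reads_subst φ x p, h1⟩, ?_⟩
    rw [List.length_append, List.length_cons]
    push_cast
    rw [add_comm (w.length : ℤ), ← add_assoc, h2]
    ring

/-- Composition of substitutions. -/
def compSubst (ψ : β → NeWord γ) (φ : α → NeWord β) (a : α) : NeWord γ :=
  ⟨(φ a).1.flatMap fun b => (ψ b).1, by
    obtain ⟨b, w, h⟩ := List.exists_cons_of_ne_nil (φ a).2
    simp [h, (ψ b).2]⟩

theorem spos_comp (ψ : β → NeWord γ) (φ : α → NeWord β) (x : ℤ → α) (i : ℤ) :
    spos ψ (subst φ x) (spos φ x i) = spos (compSubst ψ φ) x i := by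
  refine eq_pos (Q := fun i => spos ψ (subst φ x) (spos φ x i)) (by simp) (fun i => ?_) i
  simp only
  rw [spos_succ, ((reads_subst φ x i).subst ψ).2]
  rfl

theorem subst_comp (ψ : β → NeWord γ) (φ : α → NeWord β) (x : ℤ → α) :
    subst ψ (subst φ x) = subst (compSubst ψ φ) x :=
  eq_subst fun i => by
    rw [← spos_comp]
    exact ((reads_subst φ x i).subst ψ).1

end Concatenation

/-! ### Continuity of substitutions -/

section Continuity

variable {α β : Type*} [TopologicalSpace α] [DiscreteTopology α]

theorem continuous_pos_comp (l : α → ℕ) (i : ℤ) :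
    Continuous fun x : ℤ → α => pos (fun j => l (x j)) i := by
  unfold pos
  have h : Continuous fun a => (l a : ℤ) := continuous_of_discreteTopology
  exact (continuous_finsetSum _ fun j _ => h.comp (continuous_apply j)).sub
    (continuous_finsetSum _ fun j _ => h.comp (continuous_apply j))

theorem continuous_spos (φ : α → NeWord β) (i : ℤ) : Continuous fun x : ℤ → α => spos φ x i :=
  continuous_pos_comp (fun a => (φ a).1.length) i

/-- The symbol at `j` is determined by the start of one block and by the symbol producing that
block, and both are locally constant. -/
theorem continuous_subst [TopologicalSpace β] (φ : α → NeWord β) : Continuous (subst φ) := by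
  refine continuous_pi fun j => continuous_iff_continuousAt.2 fun x => ?_
  obtain ⟨i, h1, h2⟩ := exists_block (strictMono_spos φ x) j
  have e1 : ∀ᶠ y in nhds x, spos φ y i = spos φ x i :=
    (continuous_spos φ i).continuousAt.eventually (discreteTopology_iff_singleton_mem_nhds.1 inferInstance _)
  have e2 : ∀ᶠ y in nhds x, y i = x i :=
    (continuous_apply i).continuousAt.eventually
      (discreteTopology_iff_singleton_mem_nhds.1 inferInstance _)
  refine Filter.EventuallyEq.continuousAt (y := subst φ x j) ?_
  filter_upwards [e1, e2] with y h3 h4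
  obtain ⟨k, rfl⟩ := Int.le.dest h1
  rw [spos_succ] at h2
  have h5 := (reads_subst φ y i).getElem k (by rw [h4]; omega)
  have h6 := (reads_subst φ x i).getElem k (by omega)
  rw [h6, ← h3, h5]
  simp [h4]

end Continuity

end SymbolicMCG

namespace SymbolicMCG

/-! ### Walks in labeled graphs -/

section Paths

variable {B : Type*} {k : ℕ}

/-- There is a path from `p` to `q` with label `w`. -/
def Path (E : Set (Fin k × B × Fin k)) : Fin k → List B → Fin k → Prop
  | p, [], q => p = q
  | p, b :: w, q => ∃ r, (p, b, r) ∈ E ∧ Path E r w q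

variable {E : Set (Fin k × B × Fin k)}

theorem path_append {p q : Fin k} {v w : List B} :
    Path E p (v ++ w) q ↔ ∃ r, Path E p v r ∧ Path E r w q := by
  induction v generalizing p with
  | nil => simp [Path]
  | cons b v ih =>
    simp only [List.cons_append, Path, ih]
    constructor
    · rintro ⟨r, h, s, h1, h2⟩; exact ⟨s, ⟨r, h, h1⟩, h2⟩
    · rintro ⟨s, ⟨r, h, h1⟩, h2⟩; exact ⟨r, h, s, h1, h2⟩

theorem path_of_walk {x : ℤ → B} {q : ℤ → Fin k} (h : ∀ i, (q i, x i, q (i + 1)) ∈ E)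
    {p : ℤ} {w : List B} (hw : Reads x p w) : Path E (q p) w (q (p + w.length)) := by
  induction w generalizing p with
  | nil => simp [Path]
  | cons b w ih =>
    obtain ⟨rfl, hw⟩ := hw
    refine ⟨q (p + 1), h p, ?_⟩
    have := ih hw
    rw [List.length_cons]; push_cast
    rwa [add_comm (w.length : ℤ), ← add_assoc]

/-- A list of states and letters that forms a path from `p` to `q`. -/
def StatePath (E : Set (Fin k × B × Fin k)) : Fin k → List (Fin k × B) → Fin k → Prop
  | p, [], q => p = q
  | p, a :: l, q => p = a.1 ∧ ∃ r, (p, a.2, r) ∈ E ∧ StatePath E r l q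

theorem Path.exists_statePath {p q : Fin k} {w : List B} (h : Path E p w q) :
    ∃ l, StatePath E p l q ∧ l.map Prod.snd = w := by
  induction w generalizing p with
  | nil => exact ⟨[], h, rfl⟩
  | cons b w ih =>
    obtain ⟨r, h1, h2⟩ := h
    obtain ⟨l, hl, rfl⟩ := ih h2
    exact ⟨(p, b) :: l, ⟨rfl, r, h1, hl⟩, rfl⟩

theorem StatePath.edges {x : ℤ → Fin k × B} {p : ℤ} {r q : Fin k} {l : List (Fin k × B)}
    (h : StatePath E r l q) (hl : Reads x p l) (hq : (x (p + l.length)).1 = q) :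
    (x p).1 = r ∧ ∀ i : ℕ, i < l.length →
      ((x (p + i)).1, (x (p + i)).2, (x (p + i + 1)).1) ∈ E := by
  induction l generalizing p r with
  | nil => simp_all [StatePath]
  | cons a l ih =>
    obtain ⟨rfl, s, hs, h⟩ := h
    obtain ⟨rfl, hl⟩ := hl
    rw [List.length_cons] at hq; push_cast at hq
    rw [add_comm (l.length : ℤ), ← add_assoc] at hq
    obtain ⟨h1, h2⟩ := ih h hl hq
    refine ⟨rfl, fun i hi => ?_⟩
    cases i with
    | zero => simpa [h1] using hs
    | succ i =>
      have := h2 i (by simpa using hi)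
      push_cast
      rwa [add_comm (i : ℤ), ← add_assoc]

/-- A bi-infinite concatenation of labels of consecutive paths is the label of a walk. -/
theorem exists_walk_conc (b : ℤ → NeWord B) (r : ℤ → Fin k)
    (h : ∀ i, Path E (r i) (b i).1 (r (i + 1))) :
    ∃ q : ℤ → Fin k, ∀ i, (q i, conc b i, q (i + 1)) ∈ E := by
  -- Each path is lifted to a word over pairs (state, letter), so that one concatenation carries
  -- both the walk and its label.
  choose l hl hlb using fun i => (h i).exists_statePath
  let c : ℤ → NeWord (Fin k × B) := fun i => ⟨l i, fun h0 => (b i).2 (by rw [← hlb, h0]; rfl)⟩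
  have hlen : ∀ i, (c i).1.length = (b i).1.length := fun i => by
    rw [← hlb i, List.length_map]
  have hpos : ∀ i, bpos c i = bpos b i := fun i =>
    eq_pos (bpos_zero c) (fun i => by rw [bpos_succ, hlen]) i
  have hfst : ∀ i, (conc c (bpos c i)).1 = r i := fun i => by
    have h1 := reads_conc c i
    have h2 := hl i
    have h3 := (c i).2
    change l i ≠ [] at h3
    change Reads _ _ (l i) at h1
    revert h1 h2 h3
    cases l i with
    | nil => simp
    | cons a l => intro h2 _ h1; rw [h1.1, h2.1]
  have hb : conc b = fun i => (conc c i).2 := (eq_conc fun i => by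
    rw [← hpos, ← hlb i]
    refine reads_of_getElem fun j hj => ?_
    rw [(reads_conc c i).getElem j (by simpa using hj)]
    simp [c]).symm
  refine ⟨fun i => (conc c i).1, fun j => ?_⟩
  rw [hb]
  obtain ⟨i, h1, h2⟩ := exists_block (strictMono_bpos c) j
  obtain ⟨n, rfl⟩ := Int.le.dest h1
  rw [bpos_succ] at h2
  refine ((hl i).edges (reads_conc c i) ?_).2 n (by simpa [c] using h2)
  have := hfst (i + 1)
  rwa [bpos_succ] at this

/-- Replacing the blocks of the label of a walk by blocks that label the same paths. -/
theorem exists_walk_subst {α : Type*} {φ ψ : α → NeWord B}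
    (h : ∀ a p q, Path E p (φ a).1 q → Path E p (ψ a).1 q) {z : ℤ → α}
    (hz : ∃ q : ℤ → Fin k, ∀ i, (q i, subst φ z i, q (i + 1)) ∈ E) :
    ∃ q : ℤ → Fin k, ∀ i, (q i, subst ψ z i, q (i + 1)) ∈ E := by
  obtain ⟨q, hq⟩ := hz
  refine exists_walk_conc _ (fun i => q (spos φ z i)) fun i => h _ _ _ ?_
  simp only [spos_succ]
  exact path_of_walk hq (reads_subst φ z i)

end Paths

end SymbolicMCG

/-! ### Codings and marker occurrences -/

namespace SymbolicMCG

/-- Code words for the letters of `A` together with a marker word. Codes are read after occurrences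
of the marker, and the marker cannot overlap them except in the common suffix `block`. -/
structure Coding (A B : Type*) where
  /-- the image of a letter -/
  code : A → List B
  /-- the part of the marker preceding `block` -/
  pre : List B
  /-- the common suffix of the marker and the code words -/
  block : List B
  /-- the length of the code words -/
  len : ℕ
  len_pos : 0 < len
  block_ne_nil : block ≠ []
  length_code : ∀ a, (code a).length = len
  code_injective : Function.Injective code
  block_suffix : ∀ a, block <:+ code a
  -- Between two labels there is thus room for a full code word made of letters.
  len_le : block.length + len ≤ pre.length
  -- This makes every label of `periodic` maximal, as it is followed by `pre`.
  not_prefix : ∀ a, ¬ code a <+: pre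
  -- A later marker may overlap an earlier `block` followed by a code only in the last `block`.
  -- Every replacement ends in `block` too, so the overlap survives.
  separated : ∀ (y : ℤ → B) (e e' : ℤ) (w : List A), e < e' →
    Reads y (e - (pre ++ block).length) (pre ++ block) →
    Reads y (e' - (pre ++ block).length) (pre ++ block) →
    Reads y e (w.flatMap code) → e + w.length * len + (pre ++ block).length ≤ e' + block.length

/-- Symbols that are either a letter or a marker block followed by a word over `A`. -/
inductive Sym (A B : Type*)
  | letter (b : B)
  | label (w : List A)

instance (A B : Type*) : TopologicalSpace (Sym A B) := ⊥

instance (A B : Type*) : DiscreteTopology (Sym A B) := ⟨rfl⟩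

namespace Coding

variable {A B : Type*} (C : Coding A B)

/-- The code of a word. -/
abbrev encode (w : List A) : List B := w.flatMap C.code

/-- The marker word. -/
abbrev marker : List B := C.pre ++ C.block

/-- An occurrence of the marker ends at `e`. -/
abbrev Anchor (y : ℤ → B) (e : ℤ) : Prop := Reads y (e - C.marker.length) C.marker

theorem block_pos : 0 < C.block.length := List.length_pos_of_ne_nil C.block_ne_nil

theorem length_marker : C.marker.length = C.pre.length + C.block.length := List.length_append

theorem length_encode (w : List A) : (C.encode w).length = w.length * C.len := by
  induction w with
  | nil => simp
  | cons a w ih =>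
    rw [encode, List.flatMap_cons, List.length_append, C.length_code]
    rw [encode] at ih
    rw [ih, List.length_cons]; ring

theorem encode_append (v w : List A) : C.encode (v ++ w) = C.encode v ++ C.encode w :=
  List.flatMap_append

theorem anchor_iff (y : ℤ → B) (e : ℤ) : C.Anchor y e ↔
    Reads y (e - C.block.length - C.pre.length) C.pre ∧ Reads y (e - C.block.length) C.block := by
  rw [Anchor, reads_append, C.length_marker]
  push_cast
  rw [show e - (C.pre.length + C.block.length : ℤ) = e - C.block.length - C.pre.length by ring,
    show e - (C.block.length : ℤ) - C.pre.length + C.pre.length = e - C.block.length by ring]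

theorem sep {y : ℤ → B} {e e' : ℤ} {w : List A} (h : e < e') (he : C.Anchor y e)
    (he' : C.Anchor y e') (hw : Reads y e (C.encode w)) :
    e + w.length * C.len + C.pre.length ≤ e' := by
  have := C.separated y e e' w h he he' hw
  rw [List.length_append] at this; push_cast at this; omega

theorem sep' {y : ℤ → B} {e e' : ℤ} (h : e < e') (he : C.Anchor y e) (he' : C.Anchor y e') :
    e + C.pre.length ≤ e' := by
  simpa using C.sep h he he' (w := []) trivial

theorem block_suffix_encode (w : List A) : C.block <:+ C.block ++ C.encode w := by
  induction w using List.reverseRecOn with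
  | nil => simp
  | append_singleton w a _ =>
    rw [encode_append, ← List.append_assoc]
    exact (C.block_suffix a).trans ⟨C.block ++ C.encode w, by simp⟩

/-- If two codes are read at the same place, then one of the words is a prefix of the other. -/
theorem prefix_of_reads {y : ℤ → B} {e : ℤ} {v w : List A} (hv : Reads y e (C.encode v))
    (hw : Reads y e (C.encode w)) (h : v.length ≤ w.length) : v <+: w := by
  induction v generalizing e w with
  | nil => simp
  | cons a v ih =>
    cases w with
    | nil => simp at h
    | cons b w =>
      simp only [encode, List.flatMap_cons, reads_append, C.length_code] at hv hw
      have : a = b := C.code_injective (hv.1.unique hw.1 (by simp [C.length_code]))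
      subst this
      simpa using ih hv.2 hw.2 (by simpa using h)

/-- The substitution that replaces a label `w` by the code of `h w`, preceded by `block`. -/
def img (h : List A → List A) : Sym A B → NeWord B
  | .letter b => ⟨[b], by simp⟩
  | .label w => ⟨C.block ++ C.encode (h w), by simp [C.block_ne_nil]⟩

/-- The marker occurrences in the image of `z` are exactly those that end in the images of the
labels, immediately after `block`. -/
def Marked (h : List A → List A) (z : ℤ → Sym A B) : Prop :=
  (∀ i w, z i = .label w → C.Anchor (subst (C.img h) z) (spos (C.img h) z i + C.block.length)) ∧
  ∀ i e, spos (C.img h) z i < e → e ≤ spos (C.img h) z (i + 1) →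
    C.Anchor (subst (C.img h) z) e → (∃ w, z i = .label w) ∧
      e = spos (C.img h) z i + C.block.length

variable {C} {h h' : List A → List A} {z : ℤ → Sym A B}

theorem reads_label {i : ℤ} {w : List A} (hi : z i = .label w) :
    Reads (subst (C.img h) z) (spos (C.img h) z i) C.block ∧
    Reads (subst (C.img h) z) (spos (C.img h) z i + C.block.length) (C.encode (h w)) := by
  have := reads_subst (C.img h) z i
  rw [hi] at this
  exact (reads_append _ _ _ _).1 this

theorem spos_label {i : ℤ} {w : List A} (hi : z i = .label w) : spos (C.img h) z (i + 1) =
    spos (C.img h) z i + C.block.length + (h w).length * C.len := by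
  rw [spos_succ, hi]
  simp only [img, List.length_append, length_encode]; push_cast; ring

theorem spos_letter {i : ℤ} {b : B} (hi : z i = .letter b) : spos (C.img h) z (i + 1) =
    spos (C.img h) z i + 1 := by
  rw [spos_succ, hi]
  simp [img]

theorem apply_letter {i : ℤ} {b : B} (hi : z i = .letter b) :
    subst (C.img h) z (spos (C.img h) z i) = b := by
  have := reads_subst (C.img h) z i
  rw [hi] at this
  exact this.1

theorem reads_block_end {i : ℤ} {w : List A} (hi : z i = .label w) :
    Reads (subst (C.img h) z) (spos (C.img h) z (i + 1) - C.block.length) C.block := by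
  obtain ⟨v, hv⟩ := C.block_suffix_encode (h w)
  have h1 := reads_subst (C.img h) z i
  rw [hi] at h1
  simp only [img] at h1
  rw [← hv, reads_append] at h1
  convert h1.2 using 1
  rw [spos_label hi]
  have := congrArg List.length hv
  simp only [List.length_append, length_encode] at this
  zify at this
  linarith

/-- Consecutive labels are far apart. -/
theorem Marked.gap (hz : C.Marked h z) {i j : ℤ} {v w : List A} (hij : i < j) (hi : z i = .label v)
    (hj : z j = .label w) : spos (C.img h) z (i + 1) + C.pre.length ≤
      spos (C.img h) z j + C.block.length := by
  have := C.sep (by have := strictMono_spos (C.img h) z hij; omega) (hz.1 i v hi) (hz.1 j w hj)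
    (reads_label hi).2
  rwa [spos_label hi]

theorem letters_run {i : ℤ} {n : ℕ} (hn : ∀ j : ℕ, j < n → ∃ b, z (i + j) = .letter b) :
    spos (C.img h) z (i + n) = spos (C.img h) z i + n :=
  pos_add_const fun j hj => by obtain ⟨b, hb⟩ := hn j hj; simp [hb, img]

theorem letters_run_sub {i : ℤ} {n : ℕ} (hn : ∀ j : ℕ, 1 ≤ j → j ≤ n → ∃ b, z (i - j) = .letter b)
    (k : ℕ) (hk : k ≤ n) : spos (C.img h) z (i - k) = spos (C.img h) z i - k := by
  have := letters_run (C := C) (h := h) (z := z) (i := i - k) (n := k) fun j hj => by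
    obtain ⟨b, hb⟩ := hn (k - j) (by omega) (by omega)
    refine ⟨b, by rw [← hb]; congr 1; push_cast [Nat.cast_sub hj.le]; ring⟩
  rw [sub_add_cancel] at this
  omega

/-- The symbols before position `i` do not depend on the images of the labels, up to distance
`n`, if the labels are far enough from `i`. -/
theorem left_agree {i : ℤ} {n : ℕ} (hgap : ∀ j w, j < i → z j = .label w →
      spos (C.img h) z (j + 1) + n ≤ spos (C.img h) z i + C.block.length) (k : ℕ) (hk : 1 ≤ k)
    (hkn : k ≤ n) : subst (C.img h) z (spos (C.img h) z i - k) =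
      subst (C.img h') z (spos (C.img h') z i - k) := by
  have run : ∀ m : ℕ, (∀ j : ℕ, 1 ≤ j → j ≤ m → ∃ b, z (i - j) = .letter b) → k ≤ m →
      subst (C.img h) z (spos (C.img h) z i - k) =
        subst (C.img h') z (spos (C.img h') z i - k) := by
    intro m hm hkm
    obtain ⟨b, hb⟩ := hm k hk hkm
    rw [← letters_run_sub hm k hkm, ← letters_run_sub hm k hkm, apply_letter hb, apply_letter hb]
  -- After the last label near `i` there are only letters. By `hgap`, going back `n` symbols reaches
  -- at most the final `block` of that label, which is the same for `h` and `h'`.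
  by_cases hlab : ∃ j w, j < i ∧ i ≤ j + n ∧ z j = .label w
  · obtain ⟨j, ⟨hj, hjn, w, hw⟩, hmax⟩ := Int.exists_greatest_of_bdd
      (P := fun j => j < i ∧ i ≤ j + n ∧ ∃ w, z j = .label w) ⟨i, fun j hj => hj.1.le⟩
      (by obtain ⟨j, w, h1, h2, h3⟩ := hlab; exact ⟨j, h1, h2, w, h3⟩)
    obtain ⟨m, hm⟩ := Int.le.dest (show j + 1 ≤ i by omega)
    have hlet : ∀ l : ℕ, 1 ≤ l → l ≤ m → ∃ b, z (i - l) = .letter b := by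
      intro l h1 h2
      cases hl : z (i - l) with
      | letter b => exact ⟨b, rfl⟩
      | label v => have := hmax (i - l) ⟨by omega, by omega, v, hl⟩; omega
    by_cases hkm : k ≤ m
    · exact run m hlet hkm
    · have h1 := letters_run_sub (C := C) (h := h) hlet m le_rfl
      have h2 := letters_run_sub (C := C) (h := h') hlet m le_rfl
      have h3 := hgap j w hj hw
      rw [show i - (m : ℤ) = j + 1 by omega] at h1 h2
      obtain ⟨l, hl⟩ := Int.le.dest (show (k : ℤ) - m ≤ C.block.length by omega)
      have h4 := (reads_block_end (C := C) (h := h) hw).getElem l (by omega)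
      have h5 := (reads_block_end (C := C) (h := h') hw).getElem l (by omega)
      rw [show spos (C.img h) z i - k = spos (C.img h) z (j + 1) - C.block.length + l by omega,
        show spos (C.img h') z i - k = spos (C.img h') z (j + 1) - C.block.length + l by omega,
        h4, h5]
  · refine run n (fun j h1 h2 => ?_) hkn
    cases hj : z (i - j) with
    | letter b => exact ⟨b, rfl⟩
    | label v => exact absurd ⟨i - j, v, by omega, by omega, hj⟩ hlab

theorem reads_left {i : ℤ} {u : List B} (hgap : ∀ j w, j < i → z j = .label w →
      spos (C.img h) z (j + 1) + u.length ≤ spos (C.img h) z i + C.block.length) :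
    Reads (subst (C.img h) z) (spos (C.img h) z i - u.length) u ↔
      Reads (subst (C.img h') z) (spos (C.img h') z i - u.length) u := by
  constructor <;> intro hr <;> refine hr.congr fun k hk => ?_ <;>
  · have := left_agree (h' := h') hgap (u.length - k) (by omega) (by omega)
    push_cast [Nat.cast_sub hk.le] at this
    rw [← sub_add, ← sub_add] at this
    simp only [this]

/-- Whether the labels mark the occurrences of the marker does not depend on their images. -/
theorem Marked.change (hz : C.Marked h z) (h' : List A → List A) : C.Marked h' z := by
  have hT := C.block_pos
  have hlen := C.len_le
  have hL := C.len_pos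
  -- The `block` of the marker belongs to the label itself, and `pre` meets only symbols covered by
  -- `left_agree`.
  have anch : ∀ i w, z i = .label w →
      C.Anchor (subst (C.img h') z) (spos (C.img h') z i + C.block.length) := by
    intro i w hi
    rw [anchor_iff, add_sub_cancel_right]
    refine ⟨(reads_left (h := h) fun j v hj hv => hz.gap hj hv hi).1 ?_, (reads_label hi).1⟩
    have := hz.1 i w hi
    rw [anchor_iff, add_sub_cancel_right] at this
    exact this.1
  refine ⟨anch, fun i e h1 h2 he => ?_⟩
  cases hi : z i with
  | label w =>
    refine ⟨⟨w, rfl⟩, ?_⟩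
    rw [spos_label hi] at h2
    by_contra hne
    rcases lt_or_gt_of_ne hne with hlt | hlt
    · have := C.sep' hlt he (anch i w hi)
      omega
    · have := C.sep hlt (anch i w hi) he (reads_label hi).2
      omega
  | letter b =>
    exfalso
    have h3 : e = spos (C.img h') z (i + 1) := by
      have := spos_letter (C := C) (h := h') hi; omega
    subst h3
    -- A marker ending in a letter under `h'` obeys the same gap condition by separation, so it
    -- transfers back to `h`, where the hypothesis excludes it.
    have hgap : ∀ j w, j < i + 1 → z j = .label w → spos (C.img h') z (j + 1) +
        C.marker.length ≤ spos (C.img h') z (i + 1) + C.block.length := by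
      intro j w hj hw
      have hji : j < i := lt_of_le_of_ne (by omega) (by rintro rfl; simp [hi] at hw)
      have h4 := (strictMono_spos (C.img h') z).monotone (show j + 1 ≤ i by omega)
      have h5 := spos_label (C := C) (h := h') hw
      have : (0 : ℤ) ≤ (h' w).length * C.len := by positivity
      have := C.sep (by omega) (anch j w hw) he (reads_label hw).2
      rw [length_marker]
      push_cast
      omega
    obtain ⟨⟨w, hw⟩, -⟩ := hz.2 i (spos (C.img h) z (i + 1))
      (strictMono_spos _ _ (by omega)) le_rfl ((reads_left (h' := h) hgap).1 he)
    simp [hi] at hw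

end Coding

end SymbolicMCG

/-! ### Parses: truncation, uniqueness, existence -/

namespace SymbolicMCG

/-- `g` acts on the words of length at least `n` through their prefixes. -/
def ActsByPrefix {A : Type*} (n : ℕ) (g : List A → List A) : Prop :=
  ∀ u : List A, n ≤ u.length → ∀ v, g (u ++ v) = g u ++ v

theorem ActsByPrefix.take_drop {A : Type*} {n : ℕ} {g : List A → List A} (hg : ActsByPrefix n g)
    (u : List A) : g (u.take n) ++ u.drop n = g u := by
  rcases le_total n u.length with h | h
  · rw [← hg _ (by simpa using h), List.take_append_drop]
  · rw [List.take_of_length_le h, List.drop_of_length_le h, List.append_nil]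

namespace Coding

variable {A B : Type*} (C : Coding A B)

/-- The substitution that replaces a label `w` by the first `n` letters of `h w`, followed by the
code of the other letters. -/
def trunc (h : List A → List A) (n : ℕ) : Sym A B → NeWord (Sym A B)
  | .letter b => ⟨[.letter b], by simp⟩
  | .label w => ⟨.label ((h w).take n) :: (C.encode ((h w).drop n)).map .letter, by simp⟩

/-- Since `g` acts through the first `n` letters, the tail of `h w` may be written out as letters
before `g` is applied. -/
theorem compSubst_img_trunc {g h : List A → List A} {n : ℕ} (hg : ActsByPrefix n g) :
    compSubst (C.img g) (C.trunc h n) = C.img (g ∘ h) := by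
  have hf : ∀ l : List B, l.flatMap (fun b => ((C.img g) (.letter b)).1) = l := by
    intro l; induction l <;> simp_all [img]
  funext s
  apply Subtype.ext
  cases s with
  | letter b => simp [compSubst, trunc, img]
  | label w =>
    simp only [compSubst, trunc, List.flatMap_cons, List.flatMap_map, hf]
    simp only [img, Function.comp, List.append_assoc, ← encode_append, hg.take_drop]

theorem actsByPrefix_id (n : ℕ) : ActsByPrefix n (id : List A → List A) := fun _ _ _ => rfl

/-- The sequences of letters and labels that parse points of `X`, with labels of maximal length
up to the bound `n`. -/
def parses (X : Set (ℤ → B)) (n : ℕ) : Set (ℤ → Sym A B) :=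
  {z | subst (C.img id) z ∈ X ∧ C.Marked id z ∧ ∀ i w, z i = .label w →
    w.length ≤ n ∧ (w.length < n → ∀ a, ¬ Reads z (i + 1) ((C.code a).map .letter))}

/-- Membership in `X` does not depend on the images of the labels. -/
def Stable (X : Set (ℤ → B)) : Prop :=
  ∀ h h' z, subst (C.img h) z ∈ X → subst (C.img h') z ∈ X

variable {C} {X : Set (ℤ → B)} {n m : ℕ} {h : List A → List A} {z z' : ℤ → Sym A B}

theorem img_trunc {g : List A → List A} (hg : ActsByPrefix n g) (h : List A → List A)
    (z : ℤ → Sym A B) : subst (C.img g) (subst (C.trunc h n) z) = subst (C.img (g ∘ h)) z := by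
  rw [subst_comp, compSubst_img_trunc C hg]

theorem spos_img_trunc {g : List A → List A} (hg : ActsByPrefix n g) (h : List A → List A)
    (z : ℤ → Sym A B) (i : ℤ) : spos (C.img g) (subst (C.trunc h n) z) (spos (C.trunc h n) z i) =
      spos (C.img (g ∘ h)) z i := by
  rw [spos_comp, compSubst_img_trunc C hg]

theorem label_of_trunc {i : ℤ} {w : List A} (hi : subst (C.trunc h n) z i = .label w) :
    ∃ j v, z j = .label v ∧ i = spos (C.trunc h n) z j ∧ w = (h v).take n := by
  obtain ⟨j, h1, h2⟩ := exists_block (strictMono_spos (C.trunc h n) z) i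
  rw [spos_succ] at h2
  obtain ⟨k, rfl⟩ := Int.le.dest h1
  have h3 := (reads_subst (C.trunc h n) z j).getElem k (by omega)
  rw [hi] at h3
  cases hj : z j with
  | letter b =>
    rw [hj] at h2
    simp only [trunc, List.length_singleton] at h2
    obtain rfl : k = 0 := by omega
    simp [hj, trunc] at h3
  | label v =>
    cases k with
    | zero =>
      simp only [hj, trunc, List.getElem_cons_zero] at h3
      injection h3 with h3
      exact ⟨j, v, hj, by simp, h3⟩
    | succ k => simp [hj, trunc] at h3

theorem reads_of_trunc {i : ℤ} {l : List B}
    (hl : Reads (subst (C.trunc h n) z) (spos (C.trunc h n) z i) (l.map .letter)) :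
    Reads z i (l.map .letter) := by
  induction l generalizing i with
  | nil => simp
  | cons b l ih =>
    obtain ⟨h1, h2⟩ := hl
    have h3 := reads_subst (C.trunc h n) z i
    have h4 := spos_succ (C.trunc h n) z i
    cases hi : z i with
    | letter c =>
      simp only [hi, trunc, List.length_singleton] at h3 h4
      rw [h3.1] at h1
      exact ⟨hi.trans h1, ih (by rw [h4]; exact h2)⟩
    | label v =>
      simp only [hi, trunc] at h3
      rw [h3.1] at h1
      simp at h1

/-- Changing the labels and parsing again. -/
theorem trunc_mem_parses {N : ℕ} (hX : C.Stable X) (hh : ∀ w, N ≤ w.length → n ≤ (h w).length)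
    (hz : z ∈ C.parses X N) : subst (C.trunc h n) z ∈ C.parses X n := by
  obtain ⟨h1, h2, h3⟩ := hz
  have hm := h2.change h
  have hT := C.block_pos
  refine ⟨?_, ⟨fun i w hi => ?_, fun i e hi1 hi2 he => ?_⟩, fun i w hi => ?_⟩
  · rw [img_trunc (actsByPrefix_id n)]
    exact hX _ _ _ h1
  · obtain ⟨j, v, hj, rfl, rfl⟩ := label_of_trunc hi
    rw [img_trunc (actsByPrefix_id n), spos_img_trunc (actsByPrefix_id n)]
    exact hm.1 j v hj
  · rw [img_trunc (actsByPrefix_id n)] at he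
    obtain ⟨j, h4, h5⟩ := exists_block' (strictMono_spos (C.img h) z) e
    obtain ⟨⟨w, hw⟩, h6⟩ := hm.2 j e h4 h5 he
    have h7 : subst (C.trunc h n) z (spos (C.trunc h n) z j) = .label ((h w).take n) := by
      have := reads_subst (C.trunc h n) z j
      simp only [hw, trunc] at this
      exact this.1
    have h8 := spos_img_trunc (C := C) (actsByPrefix_id n) h z j
    have h9 := spos_label (C := C) (h := id) h7
    have h10 : (0 : ℤ) ≤ (id ((h w).take n)).length * C.len := by positivity
    rw [Function.id_comp] at h8
    rw [h8] at h9
    -- Marker ends use intervals open on the left; passing to `e - 1` converts them to the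
    -- convention of `block_unique`.
    obtain rfl : i = spos (C.trunc h n) z j :=
      block_unique (strictMono_spos (C.img id) (subst (C.trunc h n) z)) (j := e - 1)
        (by omega) (by omega) (by omega) (by omega)
    exact ⟨⟨_, h7⟩, by rw [h8, h6]⟩
  · obtain ⟨j, v, hj, rfl, rfl⟩ := label_of_trunc hi
    refine ⟨by simp, fun hlt a ha => ?_⟩
    -- A label shorter than `n` has not been cut, so no letters were inserted after it. Moreover `v`
    -- is shorter than `N`, and its maximality in `z` applies.
    have hn : (h v).length < n := by simpa using hlt
    have h4 := spos_succ (C.trunc h n) z j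
    simp only [hj, trunc, List.drop_of_length_le hn.le, encode, List.flatMap_nil, List.map_nil,
      List.length_singleton, Nat.cast_one] at h4
    rw [← h4] at ha
    refine (h3 j v hj).2 ?_ a (reads_of_trunc ha)
    by_contra hc
    have := hh v (by omega)
    omega

theorem shift_mem_parses (hXs : ∀ x ∈ X, ∀ i, shift i x ∈ X) (hz : z ∈ C.parses X n) (m : ℤ) :
    shift m z ∈ C.parses X n := by
  obtain ⟨h1, h2, h3⟩ := hz
  refine ⟨?_, ⟨fun i w hi => ?_, fun i e hi1 hi2 he => ?_⟩, fun i w hi => ?_⟩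
  · rw [subst_shift]; exact hXs _ h1 _
  · have := h2.1 (m + i) w hi
    rw [subst_shift, Anchor, reads_shift, spos_shift]
    convert this using 1; ring
  · rw [spos_shift] at hi1 hi2 ⊢
    rw [subst_shift, Anchor, reads_shift] at he
    have := h2.2 (m + i) (spos (C.img id) z m + e) (by omega) (by rw [add_assoc]; omega)
      (by rw [Anchor]; convert he using 1; ring)
    exact ⟨this.1, by omega⟩
  · have := h3 (m + i) w hi
    simpa only [reads_shift, add_assoc] using this

/-- The labels of a parse have maximal length. -/
theorem length_le_of_parses (hz : z ∈ C.parses X n) {i : ℤ} {v w : List A} (hi : z i = .label v)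
    (hw : w.length ≤ n) (hr : Reads (subst (C.img id) z)
      (spos (C.img id) z i + C.block.length) (C.encode w)) : w.length ≤ v.length := by
  obtain ⟨h1, h2, h3⟩ := hz
  by_contra hlt
  push Not at hlt
  obtain ⟨u, rfl⟩ := C.prefix_of_reads (reads_label (h := id) hi).2 hr hlt.le
  cases u with
  | nil => simp at hlt
  | cons a u =>
    refine (h3 i v hi).2 (by omega) a ?_
    rw [encode_append, reads_append, encode, encode, List.flatMap_cons, reads_append,
      length_encode] at hr
    have h4 := hr.2.1
    have h5 := spos_label (C := C) (h := id) hi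
    push_cast at h4
    rw [← h5] at h4
    -- The next label starts at least `pre.length - block.length ≥ len` symbols later, so the
    -- additional code word consists of letters of `z`.
    have hlet : ∀ k : ℕ, k < C.len → ∃ b, z (i + 1 + k) = .letter b := by
      intro k
      induction k using Nat.strong_induction_on with
      | _ k ih =>
        intro hk
        cases hs : z (i + 1 + k) with
        | letter b => exact ⟨b, rfl⟩
        | label y =>
          have h6 := h2.gap (by omega) hi hs
          rw [letters_run fun j hj => ih j hj (by omega)] at h6
          have := C.len_le
          omega
    refine reads_of_getElem fun k hk => ?_
    rw [List.length_map] at hk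
    have hk' := hk
    rw [C.length_code] at hk
    obtain ⟨b, hb⟩ := hlet k hk
    have h7 := apply_letter (C := C) (h := id) hb
    rw [letters_run fun j hj => hlet j (by omega), h4.getElem k hk'] at h7
    rw [hb, List.getElem_map, h7]

/-- Positions inside the code of a marked word of bounded length. -/
def Interior (C : Coding A B) (n : ℕ) (y : ℤ → B) (j : ℤ) : Prop :=
  ∃ e w, C.Anchor y e ∧ w.length ≤ n ∧ Reads y e (C.encode w) ∧
    e - C.block.length < j ∧ j < e + w.length * C.len

theorem exists_label_of_anchor (hz : z ∈ C.parses X n) {e : ℤ}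
    (he : C.Anchor (subst (C.img id) z) e) :
    ∃ i w, z i = .label w ∧ e = spos (C.img id) z i + C.block.length := by
  obtain ⟨i, h1, h2⟩ := exists_block' (strictMono_spos (C.img id) z) e
  obtain ⟨⟨w, hw⟩, h⟩ := hz.2.1.2 i e h1 h2 he
  exact ⟨i, w, hw, h⟩

/-- The cut points of a parse are characterized by its image alone, which is the source of
uniqueness. -/
theorem mem_range_spos (hz : z ∈ C.parses X n) (j : ℤ) :
    j ∈ Set.range (spos (C.img id) z) ↔ ¬ C.Interior n (subst (C.img id) z) j := by
  have hQ := strictMono_spos (C.img id) z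
  constructor
  · rintro ⟨i, rfl⟩ ⟨e, w, he, hw, hr, h1, h2⟩
    obtain ⟨i', v, hi', rfl⟩ := exists_label_of_anchor hz he
    have h3 := length_le_of_parses hz hi' hw hr
    have h4 := spos_label (C := C) (h := id) hi'
    have h5 : (w.length : ℤ) * C.len ≤ v.length * C.len := by gcongr
    have h6 := hQ.lt_iff_lt.1 (show spos (C.img id) z i' < spos (C.img id) z i by omega)
    simp only [id] at h4
    have h7 := hQ.lt_iff_lt.1 (show spos (C.img id) z i < spos (C.img id) z (i' + 1) by omega)
    omega
  · intro hj
    obtain ⟨i, h1, h2⟩ := exists_block hQ j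
    refine ⟨i, ?_⟩
    by_contra hne
    cases hi : z i with
    | letter b =>
      have := spos_letter (C := C) (h := id) hi
      omega
    | label w =>
      have := spos_label (C := C) (h := id) hi
      simp only [id] at this
      exact hj ⟨_, w, hz.2.1.1 i w hi, (hz.2.2 i w hi).1, (reads_label (h := id) hi).2, by omega,
        by omega⟩

/-- Equal images have equal sets of cut points, indexed alike because 0 is the cut point of index 0.
Labels sit at the markers, and by maximality those of the two parses have equal length, hence
coincide. -/
theorem parses_injective (hz : z ∈ C.parses X n) (hz' : z' ∈ C.parses X n)
    (h : subst (C.img id) z = subst (C.img id) z') : z = z' := by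
  have hpos : spos (C.img id) z = spos (C.img id) z' := by
    refine eq_of_range_eq (strictMono_spos _ _) (strictMono_spos _ _) ?_ (by simp)
    ext j
    rw [mem_range_spos hz, mem_range_spos hz', h]
  have key : ∀ {z z' : ℤ → Sym A B}, z ∈ C.parses X n → z' ∈ C.parses X n →
      subst (C.img id) z = subst (C.img id) z' → spos (C.img id) z = spos (C.img id) z' →
      ∀ i w, z i = .label w → ∃ w', z' i = .label w' ∧ w.length ≤ w'.length := by
    intro z z' hz hz' h hpos i w hi
    have h1 := hz.2.1.1 i w hi
    rw [h] at h1
    obtain ⟨j, v, hj, h2⟩ := exists_label_of_anchor hz' h1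
    obtain rfl : i = j := (strictMono_spos (C.img id) z').injective (by rw [← hpos] at h2 ⊢; omega)
    refine ⟨v, hj, length_le_of_parses hz' hj (hz.2.2 i w hi).1 ?_⟩
    rw [← hpos, ← h]
    exact (reads_label hi).2
  funext i
  cases hi : z i with
  | label w =>
    obtain ⟨v, hv, h1⟩ := key hz hz' h hpos i w hi
    obtain ⟨w', hw', h2⟩ := key hz' hz h.symm hpos.symm i v hv
    rw [hi] at hw'
    injection hw' with hw'
    subst hw'
    rw [hv]
    have h3 : Reads _ _ (C.encode w) := (reads_label (C := C) (h := id) hi).2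
    rw [h, hpos] at h3
    rw [(C.prefix_of_reads h3 (reads_label hv).2 h1).eq_of_length (le_antisymm h1 h2)]
    rfl
  | letter b =>
    cases hi' : z' i with
    | label v =>
      obtain ⟨w, hw, -⟩ := key hz' hz h.symm hpos.symm i v hi'
      rw [hi] at hw; simp at hw
    | letter c =>
      rw [← apply_letter (C := C) (h := id) hi, ← apply_letter (C := C) (h := id) hi', h, hpos]

/-- The parse of a point is unique up to the shift. -/
theorem parses_unique (hXs : ∀ x ∈ X, ∀ i, shift i x ∈ X) (hz : z ∈ C.parses X n)
    (hz' : z' ∈ C.parses X n) {m : ℤ}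
    (h : subst (C.img id) z' = shift m (subst (C.img id) z)) :
    ∃ j, z' = shift j z ∧ m = spos (C.img id) z j := by
  have h0 : (0 : ℤ) ∈ Set.range (spos (C.img id) z') := ⟨0, by simp⟩
  rw [mem_range_spos hz', h] at h0
  have hm : m ∈ Set.range (spos (C.img id) z) := by
    rw [mem_range_spos hz]
    rintro ⟨e, w, h1, h2, h3, h4, h5⟩
    refine h0 ⟨e - m, w, ?_, h2, ?_, by omega, by omega⟩
    · rw [Anchor, reads_shift]; convert h1 using 1; ring
    · rw [reads_shift]; convert h3 using 1; ring
  obtain ⟨j, rfl⟩ := hm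
  refine ⟨j, parses_injective hz' (shift_mem_parses hXs hz j) ?_, rfl⟩
  rw [h, subst_shift]

theorem exists_maximal_word (y : ℤ → B) (e : ℤ) (n : ℕ) : ∃ w : List A, w.length ≤ n ∧
    Reads y e (C.encode w) ∧
      (w.length < n → ∀ a, ¬ Reads y (e + w.length * C.len) (C.code a)) := by
  induction n with
  | zero => exact ⟨[], by simp⟩
  | succ n ih =>
    obtain ⟨w, h1, h2, h3⟩ := ih
    by_cases ha : ∃ a, Reads y (e + w.length * C.len) (C.code a)
    · obtain ⟨a, ha⟩ := ha
      have hwn : w.length = n := le_antisymm h1 (not_lt.1 fun hlt => h3 hlt a ha)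
      refine ⟨w ++ [a], by simp [hwn], ?_, by simp [hwn]⟩
      rw [encode_append, reads_append, length_encode]
      push_cast
      exact ⟨h2, by simpa using ha⟩
    · push Not at ha
      exact ⟨w, by omega, h2, fun _ => ha⟩

/-- Every point can be parsed, up to the shift. -/
theorem exists_parse (hXs : ∀ x ∈ X, ∀ i, shift i x ∈ X) {y : ℤ → B} (hy : y ∈ X) (n : ℕ) :
    ∃ z ∈ C.parses X n, ∃ m, subst (C.img id) z = shift m y := by
  classical
  choose W hW1 hW2 hW3 using fun e => C.exists_maximal_word (A := A) y e n
  have hT := C.block_pos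
  have hlen := C.len_le
  have hL := C.len_pos
  -- These are the cut points: the positions not interior to a marked maximal code. By separation
  -- both ends of every such code lie in `K`, so `K` is unbounded in both directions.
  let K : Set ℤ := {j | ∀ e, C.Anchor y e → e - C.block.length < j → e + (W e).length * C.len ≤ j}
  have hWnn : ∀ e, (0 : ℤ) ≤ (W e).length * C.len := fun e => by positivity
  have hstart : ∀ e, C.Anchor y e → e - C.block.length ∈ K := by
    intro e he e' he' hlt
    have := C.sep (by omega) he' he (hW2 e')
    omega
  have hend : ∀ e, C.Anchor y e → e + (W e).length * C.len ∈ K := by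
    intro e he e' he' hlt
    rcases lt_trichotomy e e' with h | rfl | h
    · have := C.sep h he he' (hW2 e)
      omega
    · exact le_rfl
    · have := C.sep h he' he (hW2 e')
      have := hWnn e
      omega
  obtain ⟨Q, hQ, hQK⟩ : ∃ Q : ℤ → ℤ, StrictMono Q ∧ Set.range Q = K := by
    refine exists_strictMono_range (fun j => ?_) (fun j => ?_) <;>
    · by_cases hj : j ∈ K
      · exact ⟨j, hj, le_rfl⟩
      · simp only [K, Set.mem_ofPred_eq, not_forall] at hj
        obtain ⟨e, he, h1, h2⟩ := hj
        first
          | exact ⟨_, hend e he, by omega⟩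
          | exact ⟨_, hstart e he, by omega⟩
  have hmem : ∀ i, Q i ∈ K := fun i => hQK ▸ ⟨i, rfl⟩
  have hnext : ∀ {i j}, j ∈ K → Q i < j → Q (i + 1) ≤ j := by
    intro i j hj hlt
    rw [← hQK] at hj
    obtain ⟨i', rfl⟩ := hj
    exact hQ.monotone (by have := hQ.lt_iff_lt.1 hlt; omega)
  let z : ℤ → Sym A B := fun i =>
    if C.Anchor y (Q i + C.block.length) then .label (W (Q i + C.block.length))
    else .letter (y (Q i))
  have hz1 : ∀ i, C.Anchor y (Q i + C.block.length) →
      z i = .label (W (Q i + C.block.length)) := fun i hi => if_pos hi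
  have hz2 : ∀ i, ¬ C.Anchor y (Q i + C.block.length) → z i = .letter (y (Q i)) :=
    fun i hi => if_neg hi
  have hz3 : ∀ i w, z i = .label w →
      C.Anchor y (Q i + C.block.length) ∧ w = W (Q i + C.block.length) := by
    intro i w hi
    by_cases ha : C.Anchor y (Q i + C.block.length)
    · rw [hz1 i ha] at hi; injection hi with hi; exact ⟨ha, hi.symm⟩
    · rw [hz2 i ha] at hi; simp at hi
  have hQs : ∀ i, C.Anchor y (Q i + C.block.length) → Q (i + 1) =
      Q i + C.block.length + (W (Q i + C.block.length)).length * C.len := by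
    intro i hi
    have := hWnn (Q i + C.block.length)
    refine le_antisymm (hnext (hend _ hi) (by omega)) ?_
    have h1 := hQ (show i < i + 1 by omega)
    exact hmem (i + 1) _ hi (by omega)
  have hQl : ∀ i, ¬ C.Anchor y (Q i + C.block.length) → Q (i + 1) = Q i + 1 := by
    intro i hi
    have h1 := hQ (show i < i + 1 by omega)
    refine le_antisymm (hnext ?_ (by omega)) (by omega)
    intro e he hlt
    by_contra hc
    have h2 := hmem i e he
    refine hi ?_
    rwa [show Q i + C.block.length = e by by_contra; omega]
  have hpos : ∀ i, spos (C.img id) z i = Q i - Q 0 := by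
    intro i
    refine (eq_pos (Q := fun i => Q i - Q 0) (by simp) (fun i => ?_) i).symm
    by_cases hi : C.Anchor y (Q i + C.block.length)
    · simp only [hz1 i hi, hQs i hi, img, List.length_append, length_encode, id]
      push_cast; ring
    · simp only [hz2 i hi, hQl i hi, img, List.length_singleton]
      push_cast; ring
  have himg : subst (C.img id) z = shift (Q 0) y := by
    refine (eq_subst fun i => ?_).symm
    rw [hpos, reads_shift, add_sub_cancel]
    by_cases hi : C.Anchor y (Q i + C.block.length)
    · simp only [hz1 i hi, img, reads_append]
      refine ⟨?_, hW2 _⟩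
      rw [anchor_iff, add_sub_cancel_right] at hi
      exact hi.2
    · simp [hz2 i hi, img]
  refine ⟨z, ⟨himg ▸ hXs y hy _, ⟨fun i w hi => ?_, fun i e h1 h2 he => ?_⟩, fun i w hi => ?_⟩,
    Q 0, himg⟩
  · rw [himg, Anchor, reads_shift, hpos]
    convert (hz3 i w hi).1 using 1; ring
  · rw [himg, Anchor, reads_shift] at he
    rw [hpos] at h1 h2
    have he' : C.Anchor y (Q 0 + e) := by rw [Anchor]; convert he using 1; ring
    obtain ⟨j, hj⟩ : Q 0 + e - C.block.length ∈ Set.range Q := hQK ▸ hstart _ he'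
    have hj' : Q j + C.block.length = Q 0 + e := by omega
    have h3 := hQs j (by rwa [hj'])
    have := hWnn (Q j + C.block.length)
    obtain rfl : i = j := block_unique hQ (j := Q 0 + e - 1) (by omega) (by omega) (by omega)
      (by omega)
    exact ⟨⟨_, hz1 i (by rwa [hj'])⟩, by rw [hpos]; omega⟩
  · obtain ⟨ha, rfl⟩ := hz3 i w hi
    refine ⟨hW1 _, fun hlt a hr => hW3 _ hlt a ?_⟩
    have h1 := (hr.subst (C.img id)).1
    rw [himg, reads_shift, hpos, add_sub_cancel, hQs i ha] at h1
    convert h1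
    generalize C.code a = l
    induction l with
    | nil => rfl
    | cons b l ih => simp only [List.map_cons, List.flatMap_cons, ← ih]; rfl

end Coding

end SymbolicMCG

namespace SymbolicMCG.Coding

variable {A B : Type*} {C : Coding A B} {X : Set (ℤ → B)} {n m : ℕ}

/-! ### Compactness of the space of parses -/

section Compactness

theorem isClopen_label (i : ℤ) (P : Sym A B → Prop) : IsClopen {z : ℤ → Sym A B | P (z i)} :=
  (isClopen_discrete {s | P s}).preimage (continuous_apply i)

variable [TopologicalSpace B] [DiscreteTopology B]

theorem isClopen_reads {α Z : Type*} [TopologicalSpace α] [DiscreteTopology α]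
    [TopologicalSpace Z] {f : Z → ℤ → α} (hf : Continuous f) {p : Z → ℤ} (hp : Continuous p)
    (w : List α) : IsClopen {z | Reads (f z) (p z) w} := by
  induction w generalizing p with
  | nil => simpa using isClopen_univ
  | cons a w ih =>
    have h1 : Continuous fun z => f z (p z) := by
      refine continuous_iff_continuousAt.2 fun z => ?_
      have h2 : ∀ᶠ y in nhds z, p y = p z :=
        hp.continuousAt.eventually (discreteTopology_iff_singleton_mem_nhds.1 inferInstance _)
      have h3 : ContinuousAt (fun y => f y (p z)) z :=
        ((continuous_apply (p z)).comp hf).continuousAt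
      exact h3.congr (by filter_upwards [h2] with y hy; rw [hy])
    exact ((isClopen_discrete {a}).preimage h1).inter (ih (by fun_prop))

theorem isClosed_forall_imp {Z ι κ : Type*} [TopologicalSpace Z] {P Q : ι → κ → Z → Prop}
    (hP : ∀ i j, IsOpen {z | P i j z}) (hQ : ∀ i j, IsClosed {z | Q i j z}) :
    IsClosed {z | ∀ i j, P i j z → Q i j z} := by
  have : {z | ∀ i j, P i j z → Q i j z} = ⋂ i, ⋂ j, {z | P i j z → Q i j z} := by ext; simp
  rw [this]
  exact isClosed_iInter fun i => isClosed_iInter fun j => isClosed_imp (hP i j) (hQ i j)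

theorem isClosed_parses (hX : IsClosed X) (n : ℕ) : IsClosed (C.parses X n) := by
  have hs := continuous_subst (C.img (id : List A → List A))
  have hp := fun i => continuous_spos (C.img (id : List A → List A)) i
  have hanch : ∀ {p : (ℤ → Sym A B) → ℤ}, Continuous p →
      IsClopen {z | C.Anchor (subst (C.img id) z) (p z)} := fun hc =>
    isClopen_reads hs (by fun_prop) _
  refine (hX.preimage hs).inter (IsClosed.inter (IsClosed.inter
    (isClosed_forall_imp (fun i w => (isClopen_label i (· = .label w)).isOpen)
      fun i w => (hanch ?_).isClosed)
    (isClosed_forall_imp (fun i e => ((isClopen_discrete (Set.Iio e)).preimage (hp i)).isOpen)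
      fun i e => ?_))
    (isClosed_forall_imp (fun i w => (isClopen_label i (· = .label w)).isOpen) fun i w => ?_))
  · have := hp i
    fun_prop
  · refine isClosed_imp
      ((isClopen_discrete (Set.Ici e)).preimage (hp (i + 1))).isOpen ?_
    refine isClosed_imp (hanch continuous_const).isOpen ?_
    exact ((isClopen_label i fun s => ∃ w, s = .label w).inter
      ((isClopen_discrete {p | e = p + C.block.length}).preimage (hp i))).isClosed
  · refine isClosed_const.inter ?_
    have := isClosed_forall_imp (Z := ℤ → Sym A B) (ι := Unit) (κ := A)
      (P := fun _ _ _ => w.length < n)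
      (Q := fun _ a z => ¬ Reads z (i + 1) ((C.code a).map .letter)) (fun _ _ => isOpen_const)
      fun _ a => (isClopen_reads continuous_id continuous_const _).compl.isClosed
    have he : {z : ℤ → Sym A B | ∀ (_ : Unit) (a : A), w.length < n →
        ¬ Reads z (i + 1) ((C.code a).map .letter)} = {z | w.length < n → ∀ a,
        ¬ Reads z (i + 1) ((C.code a).map .letter)} :=
      Set.ext fun z => ⟨fun h hw a => h () a hw, fun h _ a hw => h hw a⟩
    rwa [he] at this

theorem isCompact_parses [Finite A] [Finite B] (hX : IsClosed X) (n : ℕ) :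
    IsCompact (C.parses X n) := by
  let F : Set (Sym A B) := Set.range .letter ∪ Sym.label '' {w | w.length < n + 1}
  have hF : F.Finite := (Set.finite_range _).union ((List.finite_length_lt A (n + 1)).image _)
  refine (isCompact_univ_pi fun _ : ℤ => hF.isCompact).of_isClosed_subset
    (isClosed_parses hX n) fun z hz i _ => ?_
  cases hi : z i with
  | letter b => exact Or.inl ⟨b, rfl⟩
  | label w => exact Or.inr ⟨w, Nat.lt_succ_of_le (hz.2.2 i w hi).1, rfl⟩

end Compactness

/-- This bound provides the compact time interval in `isQuotientMap_mk_parse`. -/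
theorem exists_length_bound (n : ℕ) : ∃ M : ℕ, ∀ z ∈ C.parses X n, ∀ i,
    spos (C.img id) z (i + 1) ≤ spos (C.img id) z i + M := by
  refine ⟨C.block.length + n * C.len + 1, fun z hz i => ?_⟩
  cases hi : z i with
  | letter b => rw [spos_letter hi]; push_cast; nlinarith
  | label w =>
    have h1 := (hz.2.2 i w hi).1
    have h2 : (w.length : ℤ) * C.len ≤ n * C.len := by gcongr
    rw [spos_label hi]; simp only [id]; push_cast; omega

/-! ### Periodic points that test the action -/

section Periodic

theorem spos_const {β : Type*} (b : NeWord β) (i : ℤ) :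
    spos (fun _ : Unit => b) (fun _ => ()) i = i * b.1.length :=
  (eq_pos (Q := fun i => i * (b.1.length : ℤ)) (by simp) (fun i => by ring) i).symm

variable (C)

/-- The period of `periodic`. -/
def periodBlock (w : List A) : NeWord (Sym A B) := ⟨C.pre.map .letter ++ [.label w], by simp⟩

/-- The periodic sequence in which all labels are equal to `w`. -/
noncomputable def periodic (w : List A) : ℤ → Sym A B :=
  subst (fun _ : Unit => C.periodBlock w) fun _ => ()

/-- The image of the period of `periodic`. -/
def periodImage (w : List A) : NeWord B := ⟨C.marker ++ C.encode w, by simp [C.block_ne_nil]⟩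

theorem compSubst_periodBlock (h : List A → List A) (w : List A) :
    compSubst (C.img h) (fun _ : Unit => C.periodBlock w) = fun _ => C.periodImage (h w) := by
  have hf : ∀ l : List B, l.flatMap (fun b => ((C.img h) (.letter b)).1) = l := by
    intro l; induction l <;> simp_all [img]
  funext _
  apply Subtype.ext
  simp only [compSubst, periodBlock, periodImage, List.flatMap_append, List.flatMap_map, hf,
    List.flatMap_singleton]
  simp [img]

theorem subst_periodic (h : List A → List A) (w : List A) : subst (C.img h) (C.periodic w) =
    subst (fun _ : Unit => C.periodImage (h w)) fun _ => () := by
  rw [periodic, subst_comp, compSubst_periodBlock]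

theorem spos_periodic (h : List A → List A) (w : List A) (j : ℤ) :
    spos (C.img h) (C.periodic w) (j * (C.pre.length + 1 : ℕ)) =
      j * (C.marker.length + (C.encode (h w)).length : ℕ) := by
  have h1 := spos_comp (C.img h) (fun _ : Unit => C.periodBlock w) (fun _ => ()) j
  rw [compSubst_periodBlock, spos_const, spos_const, ← periodic] at h1
  simpa only [periodBlock, periodImage, List.length_append, List.length_map,
    List.length_singleton] using h1

theorem reads_periodic (w : List A) (j : ℤ) :
    Reads (C.periodic w) (j * (C.pre.length + 1 : ℕ)) (C.pre.map .letter) ∧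
      C.periodic w (j * (C.pre.length + 1 : ℕ) + C.pre.length) = .label w := by
  have := reads_subst (fun _ : Unit => C.periodBlock w) (fun _ => ()) j
  rw [spos_const, ← periodic] at this
  simpa only [periodBlock, reads_append, reads_cons, reads_nil, and_true, List.length_append,
    List.length_map, List.length_singleton] using this

variable {C}

theorem eq_of_periodic_label {w v : List A} {i : ℤ} (hi : C.periodic w i = .label v) :
    v = w ∧ ∃ j : ℤ, i = j * (C.pre.length + 1 : ℕ) + C.pre.length := by
  have h1 := Int.emod_add_mul_ediv i (C.pre.length + 1 : ℕ)
  have h2 := Int.emod_nonneg i (b := (C.pre.length + 1 : ℕ)) (by positivity)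
  have h3 := Int.emod_lt_of_pos i (b := (C.pre.length + 1 : ℕ)) (by positivity)
  obtain ⟨k, hk⟩ := Int.eq_ofNat_of_zero_le h2
  have h4 := C.reads_periodic w (i / (C.pre.length + 1 : ℕ))
  rw [hk, mul_comm, add_comm] at h1
  rw [hk] at h3
  rcases (show k ≤ C.pre.length by omega).lt_or_eq with h | h
  · have h5 := h4.1.getElem k (by simpa using h)
    rw [h1, hi] at h5
    simp at h5
  · rw [h] at h1
    rw [h1, hi] at h4
    injection h4.2 with h5
    exact ⟨h5, _, h1.symm⟩

theorem spos_periodic_label (h : List A → List A) (w : List A) (j : ℤ) :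
    spos (C.img h) (C.periodic w) (j * (C.pre.length + 1 : ℕ) + C.pre.length) =
      spos (C.img h) (C.periodic w) (j * (C.pre.length + 1 : ℕ)) + C.pre.length :=
  letters_run fun k hk => ⟨C.pre[k], by
    rw [(C.reads_periodic w j).1.getElem k (by simpa using hk), List.getElem_map]⟩

/-- By `Marked.change` all labels may be sent to the empty word, and then the image is the marker
repeated periodically. -/
theorem marked_periodic (w : List A) (h : List A → List A) : C.Marked h (C.periodic w) := by
  suffices C.Marked (fun _ => []) (C.periodic w) from this.change h
  have hT := C.block_pos
  have hL := C.len_pos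
  have hlen := C.len_le
  have hmk := C.length_marker
  have hp := fun j => C.spos_periodic (fun _ => []) w j
  have hpl := fun j => spos_periodic_label (C := C) (fun _ => []) w j
  simp only [encode, List.flatMap_nil, List.length_nil, add_zero] at hp
  have hy := C.subst_periodic (fun _ => []) w
  have hanch : ∀ j : ℤ, C.Anchor (subst (C.img fun _ => []) (C.periodic w))
      (j * (C.marker.length : ℤ)) := by
    intro j
    have h1 := reads_subst (fun _ : Unit => C.periodImage []) (fun _ => ()) (j - 1)
    rw [spos_const, ← hy] at h1
    simp only [periodImage, encode, List.flatMap_nil, List.append_nil] at h1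
    rwa [sub_one_mul] at h1
  refine ⟨fun i v hi => ?_, fun i e h1 h2 he => ?_⟩
  · obtain ⟨-, j, rfl⟩ := eq_of_periodic_label hi
    rw [hpl, hp]
    convert hanch (j + 1) using 1
    rw [hmk]; push_cast; ring
  · obtain ⟨j, h3, h4⟩ := exists_block' (Q := fun j : ℤ => j * (C.marker.length : ℤ))
      (fun a b hab => mul_lt_mul_of_pos_right hab (by rw [hmk]; omega)) e
    simp only [add_one_mul] at h3 h4
    -- A marker strictly between two consecutive copies would be `pre.length` away from both ends,
    -- but these are only `pre.length + block.length < 2 * pre.length` apart.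
    have h5 : e = (j + 1) * (C.marker.length : ℤ) := by
      rw [add_one_mul]
      by_contra hne
      have h6 := C.sep' h3 (hanch j) he
      have h7 := C.sep' (lt_of_le_of_ne h4 hne) he
        (by have := hanch (j + 1); rwa [add_one_mul] at this)
      omega
    have h6 := (C.reads_periodic w j).2
    have h7 : spos (C.img fun _ => []) (C.periodic w)
        (j * (C.pre.length + 1 : ℕ) + C.pre.length) + C.block.length = e := by
      rw [hpl, hp, h5, hmk]; push_cast; ring
    have h8 := spos_label (C := C) (h := fun _ => []) h6
    simp only [List.length_nil] at h8
    obtain rfl : i = j * (C.pre.length + 1 : ℕ) + C.pre.length :=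
      block_unique (strictMono_spos (C.img fun _ => []) (C.periodic w)) (j := e - 1)
        (by omega) (by omega) (by omega) (by omega)
    exact ⟨⟨w, h6⟩, h7.symm⟩

theorem periodic_mem_parses (hX : C.Stable X) {v : List A}
    (hv : subst (fun _ : Unit => C.periodImage v) (fun _ => ()) ∈ X) {w : List A}
    (hw : w.length ≤ n) : C.periodic w ∈ C.parses X n := by
  refine ⟨hX (fun _ => v) _ _ (by rwa [subst_periodic]), marked_periodic w _, fun i u hi => ?_⟩
  obtain ⟨rfl, j, rfl⟩ := eq_of_periodic_label hi
  refine ⟨hw, fun _ a ha => C.not_prefix a ?_⟩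
  have h1 := (C.reads_periodic u (j + 1)).1
  rw [show j * ((C.pre.length + 1 : ℕ) : ℤ) + C.pre.length + 1 =
    (j + 1) * ((C.pre.length + 1 : ℕ) : ℤ) by push_cast; ring] at ha
  have hle : (C.code a).length ≤ C.pre.length := by
    rw [C.length_code]; have := C.len_le; omega
  rw [List.prefix_iff_eq_take]
  refine List.ext_getElem (by simpa using hle) fun k h2 h3 => ?_
  have h4 := ha.getElem k (by simpa using h2)
  rw [h1.getElem k (by simp; omega)] at h4
  simp only [List.getElem_map] at h4
  injection h4 with h4
  rw [← h4, List.getElem_take]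

theorem subst_img_periodic (h : List A → List A) (w : List A) :
    subst (C.img h) (C.periodic w) = subst (C.img id) (C.periodic (h w)) := by
  rw [subst_periodic, subst_periodic]; rfl

theorem eq_of_shift_periodic {v w : List A} {m : ℤ} (h : C.periodic v = shift m (C.periodic w)) :
    v = w := by
  have h1 := (C.reads_periodic v 0).2
  rw [h] at h1
  exact (eq_of_periodic_label h1).1

end Periodic

end SymbolicMCG.Coding

namespace SymbolicMCG

/-! ### Polynomial growth in the absence of two loops of equal length -/

section Kleene

variable {B : Type*} {k : ℕ}

/-- There is a path from `p` to `q` with label `w` whose intermediate states lie in `V`. -/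
inductive InnerPath (E : Set (Fin k × B × Fin k)) (V : Finset (Fin k)) :
    Fin k → List B → Fin k → Prop
  | nil (p) : InnerPath E V p [] p
  | single {p b q} : (p, b, q) ∈ E → InnerPath E V p [b] q
  | cons {p b r w q} : (p, b, r) ∈ E → r ∈ V → InnerPath E V r w q → InnerPath E V p (b :: w) q

variable {E : Set (Fin k × B × Fin k)}

theorem InnerPath.path {V : Finset (Fin k)} {p q : Fin k} {w : List B}
    (h : InnerPath E V p w q) : Path E p w q := by
  induction h with
  | nil p => rfl
  | single h => exact ⟨_, h, rfl⟩
  | cons h _ _ ih => exact ⟨_, h, ih⟩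

theorem Path.innerPath {p q : Fin k} {w : List B} (h : Path E p w q) :
    InnerPath E Finset.univ p w q := by
  induction w generalizing p with
  | nil =>
    obtain rfl : p = q := h
    exact .nil p
  | cons b w ih =>
    obtain ⟨r, h1, h2⟩ := h
    exact .cons h1 (Finset.mem_univ r) (ih h2)

theorem InnerPath.length_le {p q : Fin k} {w : List B} (h : InnerPath E ∅ p w q) :
    w.length ≤ 1 := by
  cases h with
  | nil => simp
  | single => simp
  | cons _ h => simp at h

/-- A path splits at its first and last visits of an intermediate state `r`. -/
theorem InnerPath.split {V : Finset (Fin k)} {r p q : Fin k} {w : List B}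
    (h : InnerPath E (insert r V) p w q) : InnerPath E V p w q ∨ ∃ w₁ w₂ w₃,
      w = w₁ ++ (w₂ ++ w₃) ∧ InnerPath E V p w₁ r ∧ Path E r w₂ r ∧ InnerPath E V r w₃ q := by
  induction h with
  | nil p => exact .inl (.nil p)
  | single h => exact .inl (.single h)
  | @cons p b s w q h hs _ ih =>
    rcases Finset.mem_insert.1 hs with rfl | hs
    · rcases ih with ih | ⟨w₁, w₂, w₃, rfl, h1, h2, h3⟩
      · exact .inr ⟨[b], [], w, rfl, .single h, rfl, ih⟩
      · exact .inr ⟨[b], w₁ ++ w₂, w₃, by simp, .single h, path_append.2 ⟨_, h1.path, h2⟩, h3⟩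
    · rcases ih with ih | ⟨w₁, w₂, w₃, rfl, h1, h2, h3⟩
      · exact .inl (.cons h hs ih)
      · exact .inr ⟨b :: w₁, w₂, w₃, rfl, .cons h hs h1, h2, h3⟩

variable [Finite B]

/-- The labels of length `n` of the paths with intermediate states in `V`. -/
noncomputable def innerLabels (E : Set (Fin k × B × Fin k)) (V : Finset (Fin k)) (n : ℕ) :
    Finset (List B) :=
  (show {w : List B | w.length = n ∧ ∃ p q, InnerPath E V p w q}.Finite from
    (List.finite_length_eq B n).subset fun _ h => h.1).toFinset

theorem mem_innerLabels {V : Finset (Fin k)} {n : ℕ} {w : List B} :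
    w ∈ innerLabels E V n ↔ w.length = n ∧ ∃ p q, InnerPath E V p w q := by
  simp [innerLabels]

/-- If every state has at most one loop label of each length, then the number of labels of paths
grows at most polynomially. -/
theorem card_innerLabels_le
    (hE : ∀ p v w, v.length = w.length → Path E p v p → Path E p w p → v = w)
    (V : Finset (Fin k)) : ∃ c d : ℕ, ∀ n, (innerLabels E V n).card ≤ c * (n + 1) ^ d := by
  classical
  induction V using Finset.induction_on with
  | empty =>
    have hf : {w : List B | w.length < 2}.Finite := List.finite_length_lt B 2
    refine ⟨hf.toFinset.card, 0, fun n => ?_⟩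
    rw [pow_zero, mul_one]
    refine Finset.card_le_card fun w hw => ?_
    obtain ⟨-, p, q, h⟩ := mem_innerLabels.1 hw
    have := h.length_le
    simp; omega
  | insert r V _ ih =>
    obtain ⟨c, d, hcd⟩ := ih
    have hloop : ∀ m, ∃ l : List B, ∀ w : List B, w.length = m → Path E r w r → w = l := by
      intro m
      by_cases h : ∃ l : List B, l.length = m ∧ Path E r l r
      · obtain ⟨l, h1, h2⟩ := h
        exact ⟨l, fun w hw hp => hE r w l (by omega) hp h2⟩
      · exact ⟨[], fun w hw hp => absurd ⟨w, hw, hp⟩ h⟩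
    choose l hl using hloop
    -- A path through `r` is an outer word, a loop and another outer word. There are at most `(n +
    -- 1) ^ 2` pairs of outer lengths and `(c * (n + 1) ^ d) ^ 2` pairs of outer words for each; the
    -- loop is determined by its length.
    refine ⟨c + c ^ 2, 2 * d + 2, fun n => ?_⟩
    have hsub : innerLabels E (insert r V) n ⊆ innerLabels E V n ∪
        (Finset.range (n + 1) ×ˢ Finset.range (n + 1)).biUnion fun ij =>
          (innerLabels E V ij.1 ×ˢ innerLabels E V ij.2).image fun w =>
            w.1 ++ (l (n - ij.1 - ij.2) ++ w.2) := by
      intro w hw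
      obtain ⟨hn, p, q, h⟩ := mem_innerLabels.1 hw
      rcases h.split with h | ⟨w₁, w₂, w₃, rfl, h1, h2, h3⟩
      · exact Finset.mem_union_left _ (mem_innerLabels.2 ⟨hn, p, q, h⟩)
      · refine Finset.mem_union_right _ (Finset.mem_biUnion.2 ⟨(w₁.length, w₃.length), ?_, ?_⟩)
        · simp only [List.length_append] at hn
          simp; omega
        · simp only [List.length_append] at hn
          refine Finset.mem_image.2 ⟨(w₁, w₃), Finset.mem_product.2
            ⟨mem_innerLabels.2 ⟨rfl, _, _, h1⟩, mem_innerLabels.2 ⟨rfl, _, _, h3⟩⟩, ?_⟩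
          simp only
          rw [← hl _ w₂ (by omega) h2]
    refine (Finset.card_le_card hsub).trans ((Finset.card_union_le _ _).trans ?_)
    have hpow : ∀ i, i ≤ n → (innerLabels E V i).card ≤ c * (n + 1) ^ d := fun i hi =>
      (hcd i).trans (by gcongr)
    have h2 := Finset.card_biUnion_le_card_mul (Finset.range (n + 1) ×ˢ Finset.range (n + 1))
      (fun ij => (innerLabels E V ij.1 ×ˢ innerLabels E V ij.2).image fun w =>
            w.1 ++ (l (n - ij.1 - ij.2) ++ w.2)) ((c * (n + 1) ^ d) * (c * (n + 1) ^ d))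
      (fun ij hij => by
        simp only [Finset.mem_product, Finset.mem_range] at hij
        refine Finset.card_image_le.trans ?_
        rw [Finset.card_product]
        exact Nat.mul_le_mul (hpow _ (by omega)) (hpow _ (by omega)))
    rw [Finset.card_product, Finset.card_range] at h2
    have h3 : (n + 1) ^ d ≤ (n + 1) ^ (2 * d + 2) := Nat.pow_le_pow_right (by omega) (by omega)
    calc _ ≤ c * (n + 1) ^ d + (n + 1) * (n + 1) * (c * (n + 1) ^ d * (c * (n + 1) ^ d)) :=
          Nat.add_le_add (hcd n) h2
      _ = c * (n + 1) ^ d + c ^ 2 * (n + 1) ^ (2 * d + 2) := by ring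
      _ ≤ c * (n + 1) ^ (2 * d + 2) + c ^ 2 * (n + 1) ^ (2 * d + 2) := by gcongr
      _ = _ := by ring

end Kleene

/-! ### Loops from positive entropy -/

section Entropy

variable {B : Type*} [Finite B] [TopologicalSpace B] {k : ℕ} {E : Set (Fin k × B × Fin k)}

theorem tendsto_log_div_of_le_poly {a : ℕ → ℕ} {c d : ℕ} (h : ∀ n, a n ≤ c * (n + 1) ^ d) :
    Filter.Tendsto (fun n : ℕ => Real.log (a n) / n) Filter.atTop (nhds 0) := by
  have h1 : Filter.Tendsto (fun n : ℕ => Real.log n / n) Filter.atTop (nhds 0) :=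
    (Real.isLittleO_log_id_atTop.tendsto_div_nhds_zero).comp tendsto_natCast_atTop_atTop
  -- For `n ≥ 1`, `c * (n + 1) ^ d ≤ (c + 1) * (2 * n) ^ d`; the summand 1 keeps the logarithm
  -- meaningful when `c = 0`.
  have h2 : Filter.Tendsto (fun n : ℕ => (Real.log (c + 1) + d * Real.log 2) / n + d *
      (Real.log n / n)) Filter.atTop (nhds (0 + d * 0)) :=
    (tendsto_const_div_atTop_nhds_zero_nat _).add (h1.const_mul _)
  rw [mul_zero, add_zero] at h2
  refine squeeze_zero' (Filter.Eventually.of_forall fun n => ?_) ?_ h2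
  · exact div_nonneg (Real.log_natCast_nonneg _) (Nat.cast_nonneg _)
  · filter_upwards [Filter.eventually_ge_atTop 1] with n hn
    have hn' : (1 : ℝ) ≤ n := by exact_mod_cast hn
    rw [← mul_div_assoc, ← add_div]
    refine div_le_div_of_nonneg_right ?_ (by positivity)
    rw [add_assoc, ← mul_add, ← Real.log_mul (by norm_num) (by positivity), ← Real.log_pow,
      ← Real.log_mul (by positivity) (by positivity)]
    rcases Nat.eq_zero_or_pos (a n) with h0 | h0
    · rw [h0, Nat.cast_zero, Real.log_zero]
      refine Real.log_nonneg ?_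
      have : (1 : ℝ) ≤ (2 * n) ^ d := one_le_pow₀ (by linarith)
      nlinarith [Nat.cast_nonneg (α := ℝ) c]
    · refine Real.log_le_log (by exact_mod_cast h0) ?_
      have h3 : (a n : ℝ) ≤ c * (n + 1) ^ d := by exact_mod_cast h n
      refine h3.trans ?_
      gcongr <;> linarith

/-- A sofic shift of positive entropy has two different loops of the same length at some state. -/
theorem exists_loops {X : Subshift B ℤ}
    (hX : X.carrier = {x | ∃ q : ℤ → Fin k, ∀ i : ℤ, (q i, x i, q (i + 1)) ∈ E})
    (hent : 0 < entropy X) : ∃ p v w, v.length = w.length ∧ v ≠ w ∧ Path E p v p ∧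
      Path E p w p := by
  by_contra hcon
  have hE : ∀ p v w, v.length = w.length → Path E p v p → Path E p w p → v = w := by
    intro p v w h1 h2 h3
    by_contra hne
    exact hcon ⟨p, v, w, h1, hne, h2, h3⟩
  obtain ⟨c, d, hcd⟩ := card_innerLabels_le hE Finset.univ
  have hle : ∀ n, (wordsOfLength X n).ncard ≤ c * (n + 1) ^ d := by
    intro n
    refine le_trans ?_ (hcd n)
    rw [← Set.ncard_coe_finset]
    refine Set.ncard_le_ncard_of_injOn List.ofFn ?_ List.ofFn_injective.injOn
      (Finset.finite_toSet _)
    rintro w ⟨x, hx, i, hw⟩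
    rw [hX] at hx
    obtain ⟨q, hq⟩ := hx
    have h1 := path_of_walk hq (reads_ofFn x i n)
    obtain rfl : w = fun j : Fin n => x (i + (j : ℤ)) := funext hw
    exact mem_innerLabels.2 ⟨by simp, _, _, h1.innerPath⟩
  have := (tendsto_log_div_of_le_poly hle).limsup_eq
  rw [entropy, this] at hent
  exact lt_irrefl _ hent

end Entropy

/-! ### Products of two words and their relations on states -/

section Binary

variable {B : Type*}

/-- The concatenation of copies of `u` and `v` that is coded by a list of booleans. -/
def binary (u v : List B) (l : List Bool) : List B := l.flatMap fun b => if b then v else u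

variable {u v : List B}

theorem binary_append (l l' : List Bool) :
    binary u v (l ++ l') = binary u v l ++ binary u v l' := List.flatMap_append

theorem length_binary (h : u.length = v.length) (l : List Bool) :
    (binary u v l).length = l.length * u.length := by
  induction l with
  | nil => simp [binary]
  | cons b l ih =>
    have : binary u v (b :: l) = (if b then v else u) ++ binary u v l := rfl
    rw [this, List.length_append, ih, List.length_cons, add_one_mul, add_comm]
    cases b <;> simp [h]

theorem binary_injective (h : u.length = v.length) (hne : u ≠ v) {l l' : List Bool}
    (hl : l.length = l'.length) (hb : binary u v l = binary u v l') : l = l' := by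
  induction l generalizing l' with
  | nil => exact (List.length_eq_zero_iff.1 hl.symm).symm
  | cons b l ih =>
    cases l' with
    | nil => simp at hl
    | cons b' l' =>
      have h1 := List.append_inj (show (if b then v else u) ++ binary u v l =
        (if b' then v else u) ++ binary u v l' from hb) (by cases b <;> cases b' <;> simp [h])
      rw [ih (by simpa using hl) h1.2]
      cases b <;> cases b' <;> simp_all

variable {k : ℕ} (E : Set (Fin k × B × Fin k))

/-- Two words label the same pairs of states. -/
def SameRel (v w : List B) : Prop := ∀ p q, Path E p v q ↔ Path E p w q

variable {E}

theorem SameRel.refl (w : List B) : SameRel E w w := fun _ _ => Iff.rfl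

theorem SameRel.symm {v w : List B} (h : SameRel E v w) : SameRel E w v := fun p q => (h p q).symm

theorem SameRel.trans {v w x : List B} (h : SameRel E v w) (h' : SameRel E w x) :
    SameRel E v x := fun p q => (h p q).trans (h' p q)

theorem SameRel.append {v w v' w' : List B} (h : SameRel E v v') (h' : SameRel E w w') :
    SameRel E (v ++ w) (v' ++ w') := fun p q => by
  simp only [path_append]
  exact exists_congr fun r => and_congr (h p r) (h' r q)

theorem path_binary {p : Fin k} (hu : Path E p u p) (hv : Path E p v p) (l : List Bool) :
    Path E p (binary u v l) p := by
  induction l with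
  | nil => rfl
  | cons b l ih => exact path_append.2 ⟨p, by cases b <;> simpa, ih⟩

/-- All factors define one idempotent relation, so every nonempty product does; hence codes can be
exchanged without leaving the shift. -/
theorem sameRel_binary (h : SameRel E u v) (hu : SameRel E (u ++ u) u) {l : List Bool}
    (hl : l ≠ []) : SameRel E (binary u v l) u := by
  have hb : ∀ b : Bool, SameRel E (if b then v else u) u := fun b => by
    cases b
    · exact .refl u
    · exact h.symm
  induction l with
  | nil => exact absurd rfl hl
  | cons b l ih =>
    cases l with
    | nil => simpa [binary] using hb b
    | cons c l => exact ((hb b).append (ih (by simp))).trans hu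

/-- The power of a word. -/
def wpow (w : List B) (n : ℕ) : List B := (List.replicate n w).flatten

theorem wpow_add (w : List B) (m n : ℕ) : wpow w (m + n) = wpow w m ++ wpow w n := by
  rw [wpow, List.replicate_add, List.flatten_append]; rfl

theorem SameRel.wpow {v w : List B} (h : SameRel E v w) (n : ℕ) :
    SameRel E (wpow v n) (wpow w n) := by
  induction n with
  | zero => exact .refl _
  | succ n ih =>
    rw [wpow_add, wpow_add]
    exact ih.append (by simpa [SymbolicMCG.wpow] using h)

/-- Every word has a power that labels an idempotent relation. -/
theorem exists_wpow_idempotent (w : List B) :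
    ∃ n, 0 < n ∧ SameRel E (wpow w n ++ wpow w n) (wpow w n) := by
  obtain ⟨a, b, hne, hab⟩ := Finite.exists_ne_map_eq_of_infinite
    fun n : ℕ => {x : Fin k × Fin k | Path E x.1 (wpow w n) x.2}
  wlog hlt : a < b generalizing a b
  · exact this b a hne.symm hab.symm (by omega)
  obtain ⟨c, rfl⟩ := Nat.exists_eq_add_of_lt hlt
  have h0 : SameRel E (wpow w (a + c + 1)) (wpow w a) := fun p q => by
    have := Set.ext_iff.1 hab.symm (p, q)
    exact this
  have h1 : ∀ n, a ≤ n → SameRel E (wpow w (n + (c + 1))) (wpow w n) := by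
    intro n hn
    obtain ⟨m, rfl⟩ := Nat.exists_eq_add_of_le hn
    rw [show a + m + (c + 1) = a + c + 1 + m by ring, wpow_add, wpow_add w a]
    exact h0.append (.refl _)
  have h2 : ∀ m n, a ≤ n → SameRel E (wpow w (n + m * (c + 1))) (wpow w n) := by
    intro m n hn
    induction m with
    | zero => simpa using .refl _
    | succ m ih =>
      rw [add_one_mul, ← add_assoc]
      exact (h1 _ (by omega)).trans ih
  -- The relations of powers are periodic with period `c + 1` from `a` on. This exponent is a
  -- multiple of the period and at least `a`.
  refine ⟨(a + 1) * (c + 1), by positivity, ?_⟩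
  rw [← wpow_add]
  exact h2 _ _ (by nlinarith)

/-- Two different words of the same length that label the same idempotent relation and a loop. -/
theorem exists_idempotent_pair {p : Fin k} (h : u.length = v.length) (hne : u ≠ v)
    (hu : Path E p u p) (hv : Path E p v p) : ∃ u' v' : List B, u'.length = v'.length ∧ u' ≠ v' ∧
      Path E p u' p ∧ SameRel E u' v' ∧ SameRel E (u' ++ u') u' := by
  -- There are `2 ^ (k * k + 1)` products of `k * k + 1` factors, but only `2 ^ (k * k)` relations
  -- on states.
  obtain ⟨f, g, hfg, hrel⟩ := Fintype.exists_ne_map_eq_of_card_lt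
    (fun f : Fin (k * k + 1) → Bool => {x : Fin k × Fin k |
      Path E x.1 (binary u v (List.ofFn f)) x.2}) (by
        classical
        simp only [Fintype.card_set, Fintype.card_prod, Fintype.card_fin, Fintype.card_fun,
          Fintype.card_bool]
        exact Nat.pow_lt_pow_right (by norm_num) (by omega))
  have h1 : SameRel E (binary u v (List.ofFn f)) (binary u v (List.ofFn g)) := fun p q => by
    have := Set.ext_iff.1 hrel (p, q)
    exact this
  have hlen : (binary u v (List.ofFn f)).length = (binary u v (List.ofFn g)).length := by
    simp [length_binary h]
  have h2 : binary u v (List.ofFn f) ≠ binary u v (List.ofFn g) := fun he =>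
    hfg (List.ofFn_injective (binary_injective h hne (by simp) he))
  have h3 := path_binary hu hv (List.ofFn f)
  generalize binary u v (List.ofFn f) = u' at *
  generalize binary u v (List.ofFn g) = v' at *
  obtain ⟨n, hn, hid⟩ := exists_wpow_idempotent (E := E) u'
  refine ⟨wpow u' n, wpow v' n, by simp [wpow, hlen], fun he => ?_, ?_, h1.wpow n, hid⟩
  · obtain ⟨m, rfl⟩ := Nat.exists_eq_add_of_lt hn
    rw [show 0 + m + 1 = 1 + m by ring, wpow_add, wpow_add] at he
    exact h2 (by simpa [wpow] using (List.append_inj he (by simp [wpow, hlen])).1)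
  · clear hid hn
    induction n with
    | zero => rfl
    | succ n ih =>
      rw [wpow_add]
      exact path_append.2 ⟨p, ih, by simpa [wpow] using h3⟩

end Binary

end SymbolicMCG

namespace SymbolicMCG

/-! ### The coding by two words -/

section BinaryCoding

variable {B : Type*} {u v : List B}

theorem exists_first_difference (h : u.length = v.length) (hne : u ≠ v) :
    ∃ q, ∃ hu : q < u.length, ∃ hv : q < v.length, u[q] ≠ v[q] ∧
      ∀ r (hru : r < u.length) (hrv : r < v.length), r < q → u[r] = v[r] := by
  classical
  have hex : ∃ q, ∃ hu : q < u.length, ∃ hv : q < v.length, u[q] ≠ v[q] := by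
    by_contra hcon
    push Not at hcon
    exact hne (List.ext_getElem h hcon)
  obtain ⟨hu, hv, hq⟩ := Nat.find_spec hex
  refine ⟨Nat.find hex, hu, hv, hq, fun r hru hrv hlt => ?_⟩
  have := Nat.find_min hex hlt
  push Not at this
  exact this hru hrv

theorem reads_binary_false {y : ℤ → B} {p : ℤ} {n : ℕ}
    (hy : Reads y p (binary u v (List.replicate n false))) {i : ℕ} (hi : i < n) :
    Reads y (p + i * u.length) u := by
  induction n generalizing p i with
  | zero => omega
  | succ n ih =>
    have hb : binary u v (List.replicate (n + 1) false) =
        u ++ binary u v (List.replicate n false) := rfl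
    rw [hb, reads_append] at hy
    cases i with
    | zero => simpa using hy.1
    | succ i =>
      convert ih hy.2 (i := i) (by omega) using 1
      push_cast; ring

/-- The occurrences of `u ^ (n + 1) v` are far from the ends `e` of the occurrences of `u v`. -/
theorem separated_of_reads (h : u.length = v.length) (hne : u ≠ v) {y : ℤ → B} {e e' : ℤ} {n : ℕ}
    (hlt : e < e') (he : Reads y (e - 2 * u.length) (u ++ v))
    (he' : Reads y (e' - (n + 2) * u.length)
      (binary u v (List.replicate n false) ++ (u ++ v))) : e + n * u.length < e' := by
  obtain ⟨q, hqu, hqv, hq, hmin⟩ := exists_first_difference h hne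
  rw [reads_append] at he
  -- At the first difference of `u` and `v`, the occurrence of `uv` ending at `e` breaks the period
  -- `u.length`. The word `u ^ (n + 1) v` keeps this period until its own first difference, so it
  -- cannot contain that position earlier.
  have hbreak : y (e - u.length + q) ≠ y (e - 2 * u.length + q) := by
    rw [he.1.getElem q hqu, show e - (u.length : ℤ) + q = e - 2 * u.length + u.length + q by ring,
      he.2.getElem q hqv]
    exact hq.symm
  have hb : binary u v (List.replicate n false) ++ (u ++ v) =
      binary u v (List.replicate (n + 1) false) ++ v := by
    rw [List.replicate_succ', binary_append, List.append_assoc]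
    simp [binary]
  rw [hb, reads_append, length_binary h, List.length_replicate] at he'
  by_contra hle
  push Not at hle
  obtain ⟨j, hj⟩ := Int.le.dest (show e' - (n + 1) * u.length ≤ e - u.length + q by
    rw [add_one_mul]; omega)
  have hpos : 0 < u.length := by omega
  have h1 := Nat.mod_add_div j u.length
  have h2 := Nat.mod_lt j hpos
  set r := j % u.length
  set i := j / u.length
  have hjn : (j : ℤ) < n * u.length + q := by
    rw [add_one_mul] at hj; omega
  have hin : i ≤ n := by
    by_contra hc
    have : u.length * (n + 1) ≤ u.length * i := Nat.mul_le_mul_left _ (by omega)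
    have h3 : (u.length : ℤ) * (n + 1) ≤ u.length * i := by exact_mod_cast this
    zify at h1
    nlinarith
  have h3 := (reads_binary_false he'.1 (i := i) (by omega)).getElem r h2
  zify at h1
  refine hbreak ?_
  rw [show e - 2 * (u.length : ℤ) + q = e' - (n + 2) * u.length + i * u.length + r by
    linear_combination -hj - h1, h3]
  -- One period later lies either another copy of `u`, or the part of `v` before the first
  -- difference.
  rcases hin.lt_or_eq with hin | hin
  · have h4 := (reads_binary_false he'.1 (i := i + 1) (by omega)).getElem r h2
    rw [← h4]
    congr 1
    push_cast
    linear_combination -hj - h1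
  · rw [hin] at h1
    have hrq : r < q := by
      have : (r : ℤ) + u.length * n < n * u.length + q := by rw [h1]; exact hjn
      rw [mul_comm] at this
      omega
    rw [hmin r h2 (by omega) hrq, ← he'.2.getElem r (by omega)]
    congr 1
    push_cast
    linear_combination -hj - h1

variable {A : Type*}

/-- The coding by two words of the same length. -/
def binaryCoding (h : u.length = v.length) (hne : u ≠ v) {r : ℕ} {f : A → List Bool}
    (hf : Function.Injective f) (hr : ∀ a, (f a).length = r) : Coding A B :=
  have hpos : 0 < u.length := by
    refine Nat.pos_of_ne_zero fun h0 => hne ?_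
    rw [List.eq_nil_of_length_eq_zero h0, List.eq_nil_of_length_eq_zero (h.symm.trans h0)]
  have hlen : ∀ a, (binary u v (f a ++ [false, true])).length = (r + 2) * u.length := fun a => by
    rw [length_binary h]; simp [hr]
  have huv : binary u v [false, true] = u ++ v := by simp [binary]
  { code := fun a => binary u v (f a ++ [false, true])
    -- In units of `u.length`, `r + 4` is the length `r + 2` of a code word plus the length 2 of
    -- `block`, as `len_le` requires.
    pre := binary u v (List.replicate (r + 4) false)
    block := binary u v [false, true]
    len := (r + 2) * u.length
    len_pos := by positivity
    block_ne_nil := fun h0 => by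
      have := congrArg List.length h0
      rw [length_binary h] at this
      simp at this
      exact hpos.ne' (by simp [this])
    length_code := hlen
    code_injective := fun a b hab => hf <| by
      have := binary_injective h hne (by simp [hr]) hab
      simpa using this
    block_suffix := fun a => ⟨binary u v (f a), (binary_append _ _).symm⟩
    len_le := by
      rw [length_binary h, length_binary h, ← add_mul]
      simp only [List.length_replicate, List.length_cons, List.length_nil]
      exact Nat.mul_le_mul_right _ (by omega)
    not_prefix := fun a ha => by
      have h1 : binary u v (List.replicate (r + 2) false) <+:
          binary u v (List.replicate (r + 4) false) := by
        rw [show r + 4 = r + 2 + 2 by ring, List.replicate_add (r + 2), binary_append]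
        exact List.prefix_append _ _
      have h2 := (List.prefix_of_prefix_length_le ha h1
        (by rw [hlen, length_binary h]; simp)).eq_of_length (by rw [hlen, length_binary h]; simp)
      have h3 := binary_injective h hne (by simp [hr]) h2
      have h4 : true ∈ List.replicate (r + 2) false := by rw [← h3]; simp
      simp at h4
    separated := fun y e e' w hlt he he' hw => by
      have hl : e' - ((binary u v (List.replicate (r + 4) false) ++
          binary u v [false, true]).length : ℤ) = e' - ((r + 4 : ℕ) + 2) * u.length := by
        rw [List.length_append, length_binary h, length_binary h]
        simp; ring
      rw [hl, huv] at he'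
      have he2 : Reads y (e - 2 * u.length) (u ++ v) := by
        rw [reads_append, huv] at he
        convert he.2 using 1
        rw [List.length_append]
        simp [← h]; ring
      clear he
      -- Every code word ends in `uv`, so `separated_of_reads` applies again at its end and pushes
      -- `e'` past the whole coded word.
      have key : e + w.length * ((r + 2) * u.length : ℕ) + (r + 4 : ℕ) * u.length < e' := by
        induction w generalizing e with
        | nil => simpa using separated_of_reads h hne hlt he2 he'
        | cons a w ih =>
          rw [List.flatMap_cons, reads_append, hlen] at hw
          have h1 := separated_of_reads h hne hlt he2 he'
          have h2 := ih (e := e + ((r + 2) * u.length : ℕ)) (by push_cast at h1 ⊢; nlinarith) hw.2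
            (by
              have h3 := hw.1
              rw [binary_append, huv, reads_append, length_binary h, hr] at h3
              convert h3.2 using 1
              push_cast; ring)
          rw [List.length_cons]
          push_cast at h2 ⊢
          linarith
      rw [List.length_append, length_binary h (List.replicate _ _), List.length_replicate]
      push_cast at key ⊢
      linarith }

end BinaryCoding

variable {A B : Type*}

/-- A sofic shift of positive entropy admits a coding of every finite alphabet. -/
theorem exists_coding [Finite A] [Finite B] [TopologicalSpace B] (X : Subshift B ℤ)
    (hX : IsSofic X) (hent : 0 < entropy X) : ∃ C : Coding A B, C.Stable X.carrier ∧
      subst (fun _ : Unit => C.periodImage []) (fun _ => ()) ∈ X.carrier := by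
  obtain ⟨k, E, hX⟩ := hX
  obtain ⟨p, u, v, hlen, hne, hu, hv⟩ := exists_loops hX hent
  clear hent
  obtain ⟨u, v, hlen, hne, hp, hrel, hid⟩ := exists_idempotent_pair hlen hne hu hv
  obtain ⟨r, ⟨e⟩⟩ := Finite.exists_equiv_fin A
  let f : A → List Bool := fun a => List.ofFn fun j : Fin r => decide (j = e a)
  have hf : Function.Injective f := fun a b hab => by
    have := congrFun (List.ofFn_injective hab) (e a)
    simpa using this
  let C : Coding A B := binaryCoding hlen hne hf (r := r) (by simp [f])
  have henc : ∀ w : List A, ∃ l : List Bool, C.block ++ C.encode w = binary u v (false :: l) := by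
    intro w
    refine ⟨true :: w.flatMap fun a => f a ++ [false, true], ?_⟩
    rw [show false :: true :: (w.flatMap fun a => f a ++ [false, true]) =
      [false, true] ++ w.flatMap fun a => f a ++ [false, true] from rfl, binary_append]
    congr 1
    simp only [binary, List.flatMap_assoc]
    rfl
  refine ⟨C, fun h h' z hz => ?_, ?_⟩
  · rw [hX] at hz ⊢
    refine exists_walk_subst (fun s p q hs => ?_) hz
    cases s with
    | letter b => exact hs
    | label w =>
      obtain ⟨l, hl⟩ := henc (h w)
      obtain ⟨l', hl'⟩ := henc (h' w)
      simp only [Coding.img] at hs ⊢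
      rw [hl, sameRel_binary hrel hid (by simp) p q] at hs
      rw [hl', sameRel_binary hrel hid (by simp) p q]
      exact hs
  · rw [hX]
    refine exists_walk_conc _ (fun _ => p) fun i => ?_
    simp only [Coding.periodImage, Coding.encode, List.flatMap_nil, List.append_nil]
    refine path_append.2 ⟨p, ?_, ?_⟩
    · exact (sameRel_binary hrel hid (by simp) p p).2 hp
    · exact (sameRel_binary hrel hid (by simp) p p).2 hp

end SymbolicMCG

namespace SymbolicMCG

/-! ### Topology of the mapping torus -/

section TorusTopology

variable {B : Type*} [TopologicalSpace B] {X : Subshift B ℤ}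

theorem Subshift.shift_mem {x : ℤ → B} (hx : x ∈ X.carrier) (n : ℤ) : shift n x ∈ X.carrier :=
  X.mapsTo n hx

/-- The point `[x, t]` of the mapping torus. -/
def MappingTorus.mk (p : X.carrier × ℝ) : MappingTorus X := Quotient.mk (torusSetoid X) p

namespace MappingTorus

theorem mk_surjective : Function.Surjective (mk : X.carrier × ℝ → MappingTorus X) :=
  Quotient.mk_surjective

theorem mk_eq_mk {p q : X.carrier × ℝ} : mk p = mk q ↔
    ∃ n : ℤ, (q.1 : ℤ → B) = shift n (p.1 : ℤ → B) ∧ q.2 = p.2 - (n : ℝ) :=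
  Quotient.eq (r := torusSetoid X)

@[simp] theorem flow_mk (r : ℝ) (p : X.carrier × ℝ) : flow r (mk p) = mk (p.1, p.2 + r) := rfl

theorem isQuotientMap_mk : Topology.IsQuotientMap (mk : X.carrier × ℝ → MappingTorus X) :=
  isQuotientMap_quotient_mk'

/-- The action of `ℤ` on `X × ℝ` whose orbit space is the mapping torus. -/
instance torusAction : AddAction ℤ (X.carrier × ℝ) where
  vadd n p := (⟨shift n p.1, Subshift.shift_mem p.1.2 n⟩, p.2 - n)
  zero_vadd p := Prod.ext (Subtype.ext (by
    change shift 0 _ = _; simp)) (by change p.2 - ((0 : ℤ) : ℝ) = p.2; simp)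
  add_vadd m n p := Prod.ext (Subtype.ext (by
    change shift (m + n) _ = shift m (shift n _); rw [add_comm, shift_add]))
      (by change p.2 - ((m + n : ℤ) : ℝ) = p.2 - n - m; push_cast; ring)

theorem vadd_def (n : ℤ) (p : X.carrier × ℝ) :
    n +ᵥ p = (⟨shift n p.1, Subshift.shift_mem p.1.2 n⟩, p.2 - n) := rfl

theorem mk_eq_mk_iff_mem_orbit {p q : X.carrier × ℝ} :
    mk p = mk q ↔ p ∈ AddAction.orbit ℤ q := by
  rw [eq_comm, mk_eq_mk]
  constructor
  · rintro ⟨n, h1, h2⟩; exact ⟨n, Prod.ext (Subtype.ext h1.symm) h2.symm⟩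
  · rintro ⟨n, rfl⟩; exact ⟨n, rfl, rfl⟩

theorem torusSetoid_eq : torusSetoid X = AddAction.orbitRel ℤ (X.carrier × ℝ) :=
  Setoid.ext fun _ _ => (Quotient.eq (r := torusSetoid X)).symm.trans mk_eq_mk_iff_mem_orbit

instance : ContinuousConstVAdd ℤ (X.carrier × ℝ) where
  continuous_const_vadd n := by
    simp only [vadd_def]
    refine Continuous.prodMk (Continuous.subtype_mk ?_ _) (by fun_prop)
    exact (continuous_shift n).comp (by fun_prop)

theorem isCancelVAdd : IsCancelVAdd ℤ (X.carrier × ℝ) where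
  right_cancel' m n p h := by
    have := congrArg Prod.snd h
    simpa [vadd_def] using this

/-- The integer `n` translates time by `-n`, and time is bounded on compact sets. -/
instance : ProperlyDiscontinuousVAdd ℤ (X.carrier × ℝ) where
  finite_disjoint_inter_image {K L} hK hL := by
    obtain ⟨a, ha⟩ := (hK.image continuous_snd).isBounded.exists_norm_le
    obtain ⟨b, hb⟩ := (hL.image continuous_snd).isBounded.exists_norm_le
    refine (Set.finite_Icc (-⌈a + b⌉) ⌈a + b⌉).subset ?_
    rintro n ⟨_, ⟨p, hp, rfl⟩, hL⟩
    have h1 := abs_le.1 (ha p.2 ⟨p, hp, rfl⟩)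
    have h2 := abs_le.1 (hb (p.2 - n) ⟨_, hL, rfl⟩)
    have h3 := Int.le_ceil (a + b)
    constructor
    · have : (-⌈a + b⌉ : ℝ) ≤ n := by linarith
      exact_mod_cast this
    · have : (n : ℝ) ≤ ⌈a + b⌉ := by linarith
      exact_mod_cast this

theorem isOpenQuotientMap_mk : IsOpenQuotientMap (mk : X.carrier × ℝ → MappingTorus X) where
  surjective := mk_surjective
  continuous := isQuotientMap_mk.continuous
  isOpenMap := by
    intro U hU
    rw [← isQuotientMap_mk.isOpen_preimage]
    have : mk ⁻¹' (mk '' U) = ⋃ n : ℤ, (n +ᵥ · : X.carrier × ℝ → X.carrier × ℝ) ⁻¹' U := by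
      ext p
      simp only [Set.mem_preimage, Set.mem_image, Set.mem_iUnion]
      constructor
      · rintro ⟨q, hq, h⟩
        obtain ⟨n, rfl⟩ := mk_eq_mk_iff_mem_orbit.1 h
        exact ⟨n, hq⟩
      · rintro ⟨n, h⟩
        exact ⟨_, h, mk_eq_mk_iff_mem_orbit.2 ⟨n, rfl⟩⟩
    rw [this]
    exact isOpen_iUnion fun n => hU.preimage (continuous_const_vadd n)

theorem continuous_flow : Continuous fun p : ℝ × MappingTorus X => flow p.1 p.2 := by
  rw [← (IsOpenQuotientMap.id.prodMap isOpenQuotientMap_mk).continuous_comp_iff]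
  exact isQuotientMap_mk.continuous.comp
    (f := fun p : ℝ × (X.carrier × ℝ) => (p.2.1, p.2.2 + p.1)) (by fun_prop)

variable [DiscreteTopology B]

instance [Finite B] : CompactSpace X.carrier :=
  isCompact_iff_compactSpace.1 X.isClosed.isCompact

instance [Finite B] : T2Space (MappingTorus X) := by
  change T2Space (Quotient (torusSetoid X))
  rw [torusSetoid_eq]
  infer_instance

instance [Finite B] : CompactSpace (MappingTorus X) := by
  have h : IsCompact (mk '' (Set.univ ×ˢ Set.Icc 0 1 : Set (X.carrier × ℝ))) :=
    (isCompact_univ.prod isCompact_Icc).image isQuotientMap_mk.continuous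
  refine ⟨h.of_isClosed_subset isClosed_univ fun y _ => ?_⟩
  obtain ⟨p, rfl⟩ := mk_surjective y
  refine ⟨⌊p.2⌋ +ᵥ p, ⟨trivial, ?_⟩, mk_eq_mk_iff_mem_orbit.2 ⟨_, rfl⟩⟩
  exact ⟨Int.fract_nonneg p.2, (Int.fract_lt_one p.2).le⟩

theorem isCoveringMap_mk [Finite B] : IsCoveringMap (mk : X.carrier × ℝ → MappingTorus X) := by
  have := isCancelVAdd (X := X)
  exact (isQuotientMap_mk.isAddQuotientCoveringMap_of_properlyDiscontinuousVAdd
    mk_eq_mk_iff_mem_orbit).isCoveringMap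

/-- Every path in the mapping torus stays in one orbit. -/
theorem exists_flow_of_path [Finite B] (γ : C(unitInterval, MappingTorus X)) :
    ∃ r, γ 1 = flow r (γ 0) := by
  obtain ⟨p, hp⟩ := mk_surjective (γ 0)
  obtain ⟨Γ, h1, h2⟩ := isCoveringMap_mk.exists_path_lifts γ p hp.symm
  -- The sequence coordinate of the lifted path is constant because `X` is totally disconnected.
  have h3 : (Γ 1).1 = (Γ 0).1 :=
    (isPreconnected_range (f := fun t => (Γ t).1) (by fun_prop)).subsingleton ⟨1, rfl⟩ ⟨0, rfl⟩
  refine ⟨(Γ 1).2 - (Γ 0).2, ?_⟩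
  have h4 := fun t => (congrFun h1 t).symm
  simp only [Function.comp] at h4
  rw [h4, h4, flow_mk, add_sub_cancel, ← h3]

theorem exists_flow_of_isotopic [Finite B] {f g : flowGroup X} (h : Isotopic f g)
    (y : MappingTorus X) : ∃ r, g.1 y = flow r (f.1 y) := by
  obtain ⟨F, hF, h0, h1, -⟩ := h
  obtain ⟨r, hr⟩ := exists_flow_of_path ⟨fun t => F (t, y), by fun_prop⟩
  exact ⟨r, by rw [← h0, ← h1]; exact hr⟩

end MappingTorus

end TorusTopology

end SymbolicMCG

namespace SymbolicMCG

/-! ### Time changes -/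

section Interpolation

/-- A pointwise continuous family of increasing bijections of `ℝ` is jointly continuous. -/
theorem continuous_uncurry_orderIso {Z : Type*} [TopologicalSpace Z] {Φ : Z → ℝ ≃o ℝ}
    (h : ∀ t, Continuous fun z => Φ z t) : Continuous fun p : Z × ℝ => Φ p.1 p.2 := by
  have key : ∀ {Φ : Z → ℝ ≃o ℝ}, (∀ t, Continuous fun z => Φ z t) →
      Continuous fun p : Z × ℝ => (Φ p.1).symm p.2 := by
    intro Φ h
    refine OrderTopology.continuous_iff.2 fun a => ⟨?_, ?_⟩
    · have : (fun p : Z × ℝ => (Φ p.1).symm p.2) ⁻¹' Set.Ioi a = {p | Φ p.1 a < p.2} := by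
        ext p; exact (Φ p.1).lt_symm_apply
      rw [this]
      exact isOpen_lt ((h a).comp continuous_fst) continuous_snd
    · have : (fun p : Z × ℝ => (Φ p.1).symm p.2) ⁻¹' Set.Iio a = {p | p.2 < Φ p.1 a} := by
        ext p; exact (Φ p.1).symm_apply_lt
      rw [this]
      exact isOpen_lt continuous_snd ((h a).comp continuous_fst)
  -- By `key` the inverse family is continuous, so `key` applies to it in turn.
  exact key (Φ := fun z => (Φ z).symm) fun t =>
    (key h).comp (Continuous.prodMk continuous_id continuous_const)

theorem continuous_symm_orderIso {Z : Type*} [TopologicalSpace Z] {Φ : Z → ℝ ≃o ℝ}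
    (h : ∀ t, Continuous fun z => Φ z t) (t : ℝ) : Continuous fun z => (Φ z).symm t := by
  refine OrderTopology.continuous_iff.2 fun a => ⟨?_, ?_⟩
  · have : (fun z => (Φ z).symm t) ⁻¹' Set.Ioi a = {z | Φ z a < t} := by
      ext z; exact (Φ z).lt_symm_apply
    rw [this]
    exact isOpen_lt (h a) continuous_const
  · have : (fun z => (Φ z).symm t) ⁻¹' Set.Iio a = {z | t < Φ z a} := by
      ext z; exact (Φ z).symm_apply_lt
    rw [this]
    exact isOpen_lt continuous_const (h a)

theorem continuous_trans_orderIso {Z : Type*} [TopologicalSpace Z] {Φ Ψ : Z → ℝ ≃o ℝ}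
    (hΦ : ∀ t, Continuous fun z => Φ z t) (hΨ : ∀ t, Continuous fun z => Ψ z t) (t : ℝ) :
    Continuous fun z => (Φ z).trans (Ψ z) t :=
  (continuous_uncurry_orderIso hΨ).comp (f := fun z => (z, Φ z t)) (continuous_id.prodMk (hΦ t))

/-- The piecewise linear interpolation of a strictly increasing bi-infinite sequence. -/
noncomputable def interp {Q : ℤ → ℤ} (hQ : StrictMono Q) : ℝ ≃o ℝ :=
  StrictMono.orderIsoOfSurjective (fun t => Q ⌊t⌋ + Int.fract t * (Q (⌊t⌋ + 1) - Q ⌊t⌋))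
    (by
      have hpos : ∀ i, (Q i : ℝ) < Q (i + 1) := fun i => by exact_mod_cast hQ (by omega)
      intro s t hst
      have hs := Int.fract_lt_one s
      have ht := Int.fract_nonneg t
      have h1 := hpos ⌊s⌋
      have h2 := hpos ⌊t⌋
      rcases (Int.floor_mono hst.le).eq_or_lt with h | h
      · have : Int.fract s < Int.fract t := by rw [Int.fract, Int.fract, h]; linarith
        simp only [h]
        rw [h] at h1
        nlinarith
      · have h3 : (Q (⌊s⌋ + 1) : ℝ) ≤ Q ⌊t⌋ := by exact_mod_cast hQ.monotone (by omega)
        simp only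
        nlinarith)
    (by
      intro y
      obtain ⟨i, h1, h2⟩ := exists_block hQ ⌊y⌋
      have h3 : (Q i : ℝ) ≤ y := Int.le_floor.1 h1
      have h4 : y < Q (i + 1) := Int.floor_lt.1 h2
      have h5 : (0 : ℝ) < Q (i + 1) - Q i := by linarith
      have h6 : ⌊(i : ℝ) + (y - Q i) / (Q (i + 1) - Q i)⌋ = i := by
        rw [Int.floor_eq_iff]
        exact ⟨by have : 0 ≤ (y - Q i) / (Q (i + 1) - Q i) := by
                    apply div_nonneg <;> linarith
                  linarith, by rw [add_lt_add_iff_left, div_lt_one h5]; linarith⟩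
      refine ⟨i + (y - Q i) / (Q (i + 1) - Q i), ?_⟩
      simp only [Int.fract, h6]
      rw [add_sub_cancel_left, div_mul_cancel₀ _ h5.ne']
      ring)

theorem interp_apply {Q : ℤ → ℤ} (hQ : StrictMono Q) (t : ℝ) :
    interp hQ t = Q ⌊t⌋ + Int.fract t * (Q (⌊t⌋ + 1) - Q ⌊t⌋) := rfl

theorem interp_shift {Q Q' : ℤ → ℤ} (hQ : StrictMono Q) (hQ' : StrictMono Q') {j c : ℤ}
    (h : ∀ i, Q' i = Q (j + i) - c) (t : ℝ) : interp hQ' (t - j) = interp hQ t - c := by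
  rw [interp_apply, interp_apply, Int.floor_sub_intCast, Int.fract_sub_intCast, h, h,
    show j + (⌊t⌋ - j) = ⌊t⌋ by ring, show j + (⌊t⌋ - j + 1) = ⌊t⌋ + 1 by ring]
  push_cast; ring

variable {α β : Type*}

theorem continuous_interp_spos [TopologicalSpace α] [DiscreteTopology α] (φ : α → NeWord β)
    (t : ℝ) : Continuous fun z => interp (strictMono_spos φ z) t := by
  have hc : ∀ i, Continuous fun z => ((spos φ z i : ℤ) : ℝ) := fun i =>
    Int.isClosedEmbedding_coe_real.continuous.comp (continuous_spos φ i)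
  exact (hc ⌊t⌋).add (continuous_const.mul ((hc (⌊t⌋ + 1)).sub (hc ⌊t⌋)))

theorem interp_spos_shift (φ : α → NeWord β) (z : ℤ → α) (j : ℤ) (t : ℝ) :
    interp (strictMono_spos φ (shift j z)) (t - j) =
      interp (strictMono_spos φ z) t - (spos φ z j : ℤ) :=
  interp_shift _ _ (fun i => spos_shift φ z j i) t

end Interpolation

variable {A B : Type*} (C : Coding A B)

/-- A continuous and equivariant family of time changes between the images of label sequences under
`C.img id` and `C.img g`. -/
structure TimeChange (g : List A → List A) where
  /-- the time change -/
  toFun : (ℤ → Sym A B) → ℝ ≃o ℝ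
  continuous : ∀ t, Continuous fun z => toFun z t
  equivariant : ∀ z j s, toFun (shift j z) (s - spos (C.img id) z j) =
    toFun z s - spos (C.img g) z j

namespace TimeChange

/-- The piecewise linear time change. -/
noncomputable def ofImg (g : List A → List A) : TimeChange C g where
  toFun z := (interp (strictMono_spos (C.img id) z)).symm.trans
    (interp (strictMono_spos (C.img g) z))
  continuous := continuous_trans_orderIso
    (Φ := fun z => (interp (strictMono_spos (C.img id) z)).symm)
    (continuous_symm_orderIso (continuous_interp_spos _)) (continuous_interp_spos _)
  equivariant z j s := by
    simp only [OrderIso.trans_apply]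
    rw [← interp_spos_shift]
    congr 1
    rw [OrderIso.symm_apply_eq, interp_spos_shift, OrderIso.apply_symm_apply]

variable {C} {g g' : List A → List A}

/-- Composition of time changes. -/
noncomputable def comp {n n' : ℕ} (Φ' : TimeChange C g') (Φ : TimeChange C g)
    (hg : ActsByPrefix n g) (hg' : ActsByPrefix n' g') : TimeChange C (g' ∘ g) where
  -- For a sufficiently deep parse `z`, these truncations are the parse for the first map and the
  -- parse of its image for the second.
  toFun z := (Φ.toFun (subst (C.trunc id n) z)).trans (Φ'.toFun (subst (C.trunc g n') z))
  continuous t := (continuous_uncurry_orderIso Φ'.continuous).comp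
    (Continuous.prodMk (continuous_subst _) ((Φ.continuous t).comp (continuous_subst _)))
  equivariant z j s := by
    have h1 := Φ.equivariant (subst (C.trunc id n) z) (spos (C.trunc id n) z j) s
    rw [Coding.spos_img_trunc (Coding.actsByPrefix_id n), Coding.spos_img_trunc hg,
      ← subst_shift] at h1
    have h2 := Φ'.equivariant (subst (C.trunc g n') z) (spos (C.trunc g n') z j)
      (Φ.toFun (subst (C.trunc id n) z) s)
    rw [Coding.spos_img_trunc (Coding.actsByPrefix_id n'), Coding.spos_img_trunc hg',
      ← subst_shift] at h2
    simp only [OrderIso.trans_apply]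
    rw [← h2]
    exact congrArg _ h1

/-- The convex combination of a time change with the identity. -/
noncomputable def interpolate (Φ : TimeChange C id) (c : unitInterval) : TimeChange C id where
  toFun z := StrictMono.orderIsoOfSurjective (fun s => s + c * (Φ.toFun z s - s))
    (by
      intro s t hst
      have h1 := (Φ.toFun z).strictMono hst
      have h2 := c.2.1
      have h3 := c.2.2
      simp only
      rcases h2.eq_or_lt with h | h
      · rw [← h]; linarith
      · nlinarith)
    (by
      have hc : Continuous (Φ.toFun z) := (Φ.toFun z).continuous
      -- The combination lies between `s` and `Φ.toFun z s`, which have the same infinite limits.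
      refine Continuous.surjective (by fun_prop) ?_ ?_
      · refine Filter.tendsto_atTop_mono (f := fun s => min s (Φ.toFun z s)) (fun s => ?_)
          (Filter.tendsto_atTop.2 fun b => ?_)
        swap
        · filter_upwards [Filter.eventually_ge_atTop b,
            (Φ.toFun z).tendsto_atTop.eventually_ge_atTop b] with s h1 h2 using le_min h1 h2
        have h2 := c.2.1
        have h3 := c.2.2
        rcases le_total s (Φ.toFun z s) with h | h
        · rw [min_eq_left h]; nlinarith
        · rw [min_eq_right h]; nlinarith
      · refine Filter.tendsto_atBot_mono (f := fun s => max s (Φ.toFun z s)) (fun s => ?_)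
          (Filter.tendsto_atBot.2 fun b => ?_)
        swap
        · filter_upwards [Filter.eventually_le_atBot b,
            (Φ.toFun z).tendsto_atBot.eventually_le_atBot b] with s h1 h2 using max_le h1 h2
        have h2 := c.2.1
        have h3 := c.2.2
        rcases le_total s (Φ.toFun z s) with h | h
        · rw [max_eq_right h]; nlinarith
        · rw [max_eq_left h]; nlinarith)
  continuous t := by
    have := Φ.continuous t
    change Continuous fun z => t + c * (Φ.toFun z t - t)
    fun_prop
  equivariant z j s := by
    change s - spos (C.img id) z j + c * (Φ.toFun (shift j z) (s - spos (C.img id) z j) -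
      (s - spos (C.img id) z j)) = s + c * (Φ.toFun z s - s) - spos (C.img id) z j
    rw [Φ.equivariant]; ring

end TimeChange

end SymbolicMCG

/-! ### Maps of the torus that realize the action on labels -/

namespace SymbolicMCG

variable {A B : Type*} [TopologicalSpace B] {C : Coding A B} {X : Subshift B ℤ} {n n' : ℕ}
  {g g' : List A → List A}

open MappingTorus

/-- The map `f` replaces the labels of parses by their images under `g`, with the time
change `Φ`. -/
def ImplementsAt (n : ℕ) (Φ : TimeChange C g) (f : MappingTorus X → MappingTorus X) : Prop :=
  ∀ z ∈ C.parses X.carrier n, ∀ (h : subst (C.img id) z ∈ X.carrier)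
    (hg : subst (C.img g) z ∈ X.carrier) (s : ℝ),
      f (mk (⟨_, h⟩, s)) = mk (⟨_, hg⟩, Φ.toFun z s)

/-- The level `N` is so deep that one parse can be truncated to level `n` for `f`, and its
relabeling by `g` to level `n'` for `f'`. -/
theorem ImplementsAt.comp {Φ : TimeChange C g} {Φ' : TimeChange C g'}
    {f f' : MappingTorus X → MappingTorus X} (hX : C.Stable X.carrier)
    (hf' : ImplementsAt n' Φ' f') (hf : ImplementsAt n Φ f)
    (hg : ActsByPrefix n g) (hg' : ActsByPrefix n' g') {N : ℕ} (hN : n ≤ N)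
    (hN' : ∀ w : List A, N ≤ w.length → n' ≤ (g w).length) :
    ImplementsAt N (Φ'.comp Φ hg hg') (f' ∘ f) := by
  intro z hz h1 h2 s
  have hm := hX _ g _ h1
  have e1 : subst (C.img id) (subst (C.trunc id n) z) = subst (C.img id) z :=
    Coding.img_trunc (Coding.actsByPrefix_id n) id z
  have e2 : subst (C.img g) (subst (C.trunc id n) z) = subst (C.img g) z :=
    Coding.img_trunc hg id z
  have e3 : subst (C.img id) (subst (C.trunc g n') z) = subst (C.img g) z :=
    Coding.img_trunc (Coding.actsByPrefix_id n') g z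
  have e4 : subst (C.img g') (subst (C.trunc g n') z) = subst (C.img (g' ∘ g)) z :=
    Coding.img_trunc hg' g z
  have h3 := hf _ (Coding.trunc_mem_parses hX (h := id) (fun w hw => hN.trans hw) hz)
    (by rwa [e1]) (by rwa [e2]) s
  have h4 := hf' _ (Coding.trunc_mem_parses hX hN' hz) (by rwa [e3]) (by rwa [e4])
    (Φ.toFun (subst (C.trunc id n) z) s)
  simp only [e1, e2] at h3
  simp only [e3, e4] at h4
  rw [Function.comp, h3, h4]
  rfl

/-- Two parsed presentations of a point differ by a shift of the parse, so equivariant constructions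
descend to the torus. -/
theorem mk_parse_eq (hz : ∀ z ∈ C.parses X.carrier n, subst (C.img id) z ∈ X.carrier)
    (Φ : TimeChange C g) {z z' : ℤ → Sym A B} (h : z ∈ C.parses X.carrier n)
    (h' : z' ∈ C.parses X.carrier n) {s s' : ℝ}
    (he : (mk (⟨_, hz z h⟩, s) : MappingTorus X) = mk (⟨_, hz z' h'⟩, s')) :
    ∃ j, z' = shift j z ∧ s' = s - spos (C.img id) z j ∧
      Φ.toFun z' s' = Φ.toFun z s - spos (C.img g) z j := by
  obtain ⟨m, h1, h2⟩ := mk_eq_mk.1 he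
  obtain ⟨j, rfl, rfl⟩ := Coding.parses_unique (fun x hx i => Subshift.shift_mem hx i) h h' h1
  obtain rfl : s' = s - spos (C.img id) z j := h2
  exact ⟨j, rfl, rfl, Φ.equivariant z j s⟩

theorem exists_mk_parse (n : ℕ) (y : MappingTorus X) :
    ∃ z ∈ C.parses X.carrier n, ∃ (h : subst (C.img id) z ∈ X.carrier) (s : ℝ), 0 ≤ s ∧
      s ≤ spos (C.img id) z 1 ∧ y = mk (⟨_, h⟩, s) := by
  have hs : ∀ x ∈ X.carrier, ∀ i, shift i x ∈ X.carrier := fun x hx i => Subshift.shift_mem hx i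
  obtain ⟨⟨x, t⟩, rfl⟩ := mk_surjective y
  obtain ⟨z, hz, m, hm⟩ := Coding.exists_parse (C := C) hs x.2 n
  obtain ⟨i, h1, h2⟩ := exists_block (strictMono_spos (C.img id) z) ⌊t - m⌋
  have h3 := Int.le_floor.1 h1
  have h4 := Int.floor_lt.1 h2
  have hz' := Coding.shift_mem_parses hs hz i
  refine ⟨shift i z, hz', hz'.1, t - m - spos (C.img id) z i, by linarith, ?_, ?_⟩
  · rw [spos_shift]; push_cast; linarith
  · refine mk_eq_mk.2 ⟨m + spos (C.img id) z i, ?_, by push_cast; ring⟩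
    exact (subst_shift _ _ _).trans (by rw [hm, ← shift_add])

theorem ImplementsAt.bijective {Φ : TimeChange C id} {f : MappingTorus X → MappingTorus X}
    (hf : ImplementsAt n Φ f) : Function.Bijective f := by
  constructor
  · intro y y' hy
    obtain ⟨z, hz, h, s, -, -, rfl⟩ := exists_mk_parse (C := C) n y
    obtain ⟨z', hz', h', s', -, -, rfl⟩ := exists_mk_parse (C := C) n y'
    rw [hf z hz h h, hf z' hz' h' h'] at hy
    obtain ⟨j, rfl, h1, -⟩ := mk_parse_eq (fun z hz => hz.1) Φ hz hz' hy
    rw [← Φ.equivariant, (Φ.toFun _).injective.eq_iff] at h1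
    subst h1
    exact mk_eq_mk.2 ⟨spos (C.img id) z j, subst_shift _ _ _, rfl⟩
  · intro y
    obtain ⟨z, hz, h, s, -, -, rfl⟩ := exists_mk_parse (C := C) n y
    exact ⟨mk (⟨_, h⟩, (Φ.toFun z).symm s), by rw [hf z hz h h]; simp⟩

theorem ImplementsAt.orientationPreserving {Φ : TimeChange C g} (hX : C.Stable X.carrier)
    {f : MappingTorus X → MappingTorus X} (hf : ImplementsAt n Φ f) :
    OrientationPreserving f := by
  intro y
  obtain ⟨z, hz, h, s, -, -, rfl⟩ := exists_mk_parse (C := C) n y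
  have hg := hX _ g _ h
  refine ⟨(OrderIso.addLeft s).trans ((Φ.toFun z).trans (OrderIso.addRight (-Φ.toFun z s))),
    fun t => ?_⟩
  rw [flow_mk, hf z hz h hg, hf z hz h hg, flow_mk]
  simp

/-- The homeomorphism `F` realizes the action of `g` on labels. -/
def Implements (C : Coding A B) (F : flowGroup X) (g : List A → List A) : Prop :=
  ∃ n, ActsByPrefix n g ∧ ∃ Φ : TimeChange C g, ImplementsAt n Φ F.1

section

variable [Finite A]

/-- Only finitely many words have short images, namely the preimages of the finitely many short
words. -/
theorem exists_length_le (g : veelikeGroup A) (n : ℕ) :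
    ∃ N : ℕ, n ≤ N ∧ ∀ w : List A, N ≤ w.length → n ≤ (g.1 w).length := by
  have hfin : ((fun w : List A => (g.1.symm w).length) '' {u | u.length < n}).Finite :=
    (List.finite_length_lt A n).image _
  obtain ⟨M, hM⟩ := hfin.bddAbove
  refine ⟨max n (M + 1), le_max_left _ _, fun w hw => ?_⟩
  by_contra hlt
  have := hM ⟨g.1 w, not_le.1 hlt, rfl⟩
  simp only [Equiv.symm_apply_apply] at this
  omega

theorem Implements.mul (hX : C.Stable X.carrier) {F F' : flowGroup X} {g g' : veelikeGroup A}
    (h' : Implements C F' g'.1) (h : Implements C F g.1) :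
    Implements C (F' * F) (g' * g : veelikeGroup A).1 := by
  obtain ⟨n, hg, Φ, hΦ⟩ := h
  obtain ⟨n', hg', Φ', hΦ'⟩ := h'
  obtain ⟨N, hN, hN'⟩ := exists_length_le g (max n n')
  refine ⟨N, fun u hu v => ?_, Φ'.comp Φ hg hg', hΦ'.comp hX hΦ hg hg'
    ((le_max_left _ _).trans hN) fun w hw => (le_max_right _ _).trans (hN' w hw)⟩
  change g'.1 (g.1 (u ++ v)) = g'.1 (g.1 u) ++ v
  rw [hg u (((le_max_left _ _).trans hN).trans hu), hg' _ ((le_max_right _ _).trans (hN' u hu))]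

/-- A realization of `g` that preserves all orbits is trivial. -/
theorem Implements.eq_one (hX : C.Stable X.carrier)
    (hper : subst (fun _ : Unit => C.periodImage []) (fun _ => ()) ∈ X.carrier)
    {F : flowGroup X} {g : veelikeGroup A} (h : Implements C F g.1)
    (hF : ∀ y, ∃ r, F.1 y = flow r y) : g = 1 := by
  obtain ⟨n, hg, Φ, hΦ⟩ := h
  refine Subtype.ext (Equiv.ext fun w => ?_)
  change g.1 w = w
  -- At level `N` both `w` and `g w` are admissible labels, so both periodic sequences are parses of
  -- the same level and can be compared.
  obtain ⟨N, h1, h2, h3⟩ : ∃ N, n ≤ N ∧ w.length ≤ N ∧ (g.1 w).length ≤ N :=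
    ⟨n + w.length + (g.1 w).length, by omega, by omega, by omega⟩
  have hp := Coding.periodic_mem_parses hX hper h2
  have hp' := Coding.periodic_mem_parses hX hper h3
  have e1 : subst (C.img id) (subst (C.trunc id n) (C.periodic w)) =
      subst (C.img id) (C.periodic w) :=
    Coding.img_trunc (Coding.actsByPrefix_id n) id _
  have e2 : subst (C.img g.1) (subst (C.trunc id n) (C.periodic w)) =
      subst (C.img id) (C.periodic (g.1 w)) :=
    (Coding.img_trunc hg id _).trans (Coding.subst_img_periodic _ _)
  have h4 := hΦ _ (Coding.trunc_mem_parses hX (h := id) (fun w hw => h1.trans hw) hp)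
    (by rw [e1]; exact hp.1) (by rw [e2]; exact hp'.1) 0
  obtain ⟨r, hr⟩ := hF (mk (⟨_, hp.1⟩, 0))
  simp only [e1, e2] at h4
  rw [h4, flow_mk, eq_comm] at hr
  obtain ⟨m, h5, -⟩ := mk_eq_mk.1 hr
  obtain ⟨j, h6, -⟩ := Coding.parses_unique (fun x hx i => Subshift.shift_mem hx i) hp hp' h5
  exact Coding.eq_of_shift_periodic h6

end

/-! ### Realization by homeomorphisms, and isotopy -/

variable [DiscreteTopology B] [Finite B]

/-- The homeomorphism given by a continuous map that implements the action on labels. -/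
theorem exists_flowGroup (hX : C.Stable X.carrier) {Φ : TimeChange C g}
    {f : MappingTorus X → MappingTorus X} (hc : Continuous f) (hb : Function.Bijective f)
    (hf : ImplementsAt n Φ f) : ∃ F : flowGroup X, ∀ y, F.1 y = f y :=
  ⟨⟨Continuous.homeoOfEquivCompactToT2 (f := Equiv.ofBijective f hb) hc,
    hf.orientationPreserving hX⟩, fun _ => rfl⟩

variable [Finite A]

/-- Already the restriction to a bounded time interval is a continuous surjection from a compact
space onto a Hausdorff space, hence a quotient map. Continuity on the torus can therefore be tested
on parses. -/
theorem isQuotientMap_mk_parse (n : ℕ) : Topology.IsQuotientMap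
    fun p : C.parses X.carrier n × ℝ => (mk (⟨_, p.1.2.1⟩, p.2) : MappingTorus X) := by
  obtain ⟨M, hM⟩ := Coding.exists_length_bound (C := C) (X := X.carrier) n
  have : CompactSpace (C.parses X.carrier n) :=
    isCompact_iff_compactSpace.1 (Coding.isCompact_parses X.isClosed n)
  have hcont : Continuous
      fun p : C.parses X.carrier n × ℝ => (mk (⟨_, p.1.2.1⟩, p.2) : MappingTorus X) :=
    isQuotientMap_mk.continuous.comp (Continuous.prodMk (Continuous.subtype_mk
      ((continuous_subst _).comp (continuous_subtype_val.comp continuous_fst)) _) continuous_snd)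
  have hinc : Continuous fun p : C.parses X.carrier n × Set.Icc (0 : ℝ) M => (p.1, p.2.1) := by
    fun_prop
  refine Topology.IsQuotientMap.of_comp hinc hcont
    ((hcont.comp hinc).isClosedMap.isQuotientMap (hcont.comp hinc) fun y => ?_)
  obtain ⟨z, hz, h, s, h0, h1, rfl⟩ := exists_mk_parse (C := C) n y
  refine ⟨(⟨z, hz⟩, ⟨s, h0, h1.trans ?_⟩), rfl⟩
  have := hM z hz 0
  rw [zero_add, spos_zero, zero_add] at this
  exact_mod_cast this

theorem exists_implementsAt (hX : C.Stable X.carrier) (n : ℕ) (Φ : TimeChange C g) :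
    ∃ f : MappingTorus X → MappingTorus X, Continuous f ∧ ImplementsAt n Φ f := by
  let G : C(C.parses X.carrier n × ℝ, MappingTorus X) :=
    { toFun := fun p => mk (⟨_, hX _ g _ p.1.2.1⟩, Φ.toFun p.1 p.2)
      continuous_toFun := isQuotientMap_mk.continuous.comp (Continuous.prodMk
        (Continuous.subtype_mk
          ((continuous_subst _).comp (continuous_subtype_val.comp continuous_fst)) _)
        ((continuous_uncurry_orderIso Φ.continuous).comp
          (f := fun p : C.parses X.carrier n × ℝ => (p.1.1, p.2)) (by fun_prop))) }
  have hq := isQuotientMap_mk_parse (C := C) (X := X) n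
  have hG : Function.FactorsThrough G fun p : C.parses X.carrier n × ℝ =>
      (mk (⟨_, p.1.2.1⟩, p.2) : MappingTorus X) := by
    rintro ⟨⟨z, hz⟩, s⟩ ⟨⟨z', hz'⟩, s'⟩ he
    obtain ⟨j, rfl, -, h2⟩ := mk_parse_eq (fun z hz => hz.1) Φ hz hz' he
    exact mk_eq_mk.2 ⟨spos (C.img g) z j, subst_shift _ _ _, h2⟩
  have hlift := fun p => congrFun (hG.extend_comp id) p
  refine ⟨Function.extend (fun p : C.parses X.carrier n × ℝ =>
      (mk (⟨_, p.1.2.1⟩, p.2) : MappingTorus X)) G id, ?_, fun z hz h hg s => hlift (⟨z, hz⟩, s)⟩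
  rw [hq.continuous_iff, hG.extend_comp]
  exact G.continuous

/-- A flow-preserving homeomorphism that acts trivially on labels is isotopic to the identity. -/
theorem ImplementsAt.isotopic_one (hX : C.Stable X.carrier) {Φ : TimeChange C id}
    {F : flowGroup X} (hf : ImplementsAt n Φ F.1) : Isotopic 1 F := by
  let G : C(C.parses X.carrier n × ℝ, ℝ) :=
    { toFun := fun p => Φ.toFun p.1 p.2 - p.2
      continuous_toFun := ((continuous_uncurry_orderIso Φ.continuous).comp
          (f := fun p : C.parses X.carrier n × ℝ => (p.1.1, p.2)) (by fun_prop)).sub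
            continuous_snd }
  have hq := isQuotientMap_mk_parse (C := C) (X := X) n
  have hG : Function.FactorsThrough G fun p : C.parses X.carrier n × ℝ =>
      (mk (⟨_, p.1.2.1⟩, p.2) : MappingTorus X) := by
    rintro ⟨⟨z, hz⟩, s⟩ ⟨⟨z', hz'⟩, s'⟩ he
    obtain ⟨j, rfl, h1, h2⟩ := mk_parse_eq (fun z hz => hz.1) Φ hz hz' he
    change s' = s - _ at h1
    change Φ.toFun _ s' = Φ.toFun z s - _ at h2
    change Φ.toFun z s - s = Φ.toFun _ s' - s'
    rw [h2, h1]; ring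
  -- The displacement along the orbit. It is well defined because for `g = id` both times change by
  -- the same integer under a shift of the parse; the default value 0 is never taken outside the
  -- image, which is everything.
  let c : MappingTorus X → ℝ := Function.extend (fun p : C.parses X.carrier n × ℝ =>
      (mk (⟨_, p.1.2.1⟩, p.2) : MappingTorus X)) G fun _ => 0
  have hc : Continuous c := by
    rw [hq.continuous_iff, hG.extend_comp]
    exact G.continuous
  have hcz : ∀ z (hz : z ∈ C.parses X.carrier n) (h : subst (C.img id) z ∈ X.carrier) s,
      c (mk (⟨_, h⟩, s)) = Φ.toFun z s - s :=
    fun z hz h s => congrFun (hG.extend_comp (fun _ => 0)) (⟨z, hz⟩, s)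
  have hflow : Continuous fun p : unitInterval × MappingTorus X => flow (p.1 * c p.2) p.2 :=
    continuous_flow.comp (f := fun p : unitInterval × MappingTorus X =>
      ((p.1 : ℝ) * c p.2, p.2)) (by fun_prop)
  refine ⟨fun p => flow (p.1 * c p.2) p.2, hflow, fun y => ?_, fun y => ?_, fun t => ?_⟩
  · obtain ⟨p, rfl⟩ := mk_surjective y
    simp
  · obtain ⟨z, hz, h, s, -, -, rfl⟩ := exists_mk_parse (C := C) n y
    simp [hcz z hz, hf z hz h h]
  -- The intermediate maps implement the interpolated time changes, hence are homeomorphisms.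
  · have hi : ImplementsAt n (Φ.interpolate t) fun y : MappingTorus X => flow (t * c y) y := by
      intro z hz h _ s
      simp only [hcz z hz, flow_mk]
      rfl
    obtain ⟨k, hk⟩ := exists_flowGroup hX
      (hflow.comp (Continuous.prodMk continuous_const continuous_id)) hi.bijective hi
    exact ⟨k, fun y => (hk y).symm⟩

/-- Composites of the maps for `g` and `g⁻¹`, in either order, implement the identity and so are
bijective; hence the map for `g` is both injective and surjective. -/
theorem exists_implements (hX : C.Stable X.carrier) (g : veelikeGroup A) :
    ∃ F : flowGroup X, Implements C F g.1 := by
  have key : ∀ g : veelikeGroup A, ∃ n, ActsByPrefix n g.1 ∧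
      ∃ f : MappingTorus X → MappingTorus X, Continuous f ∧
        ImplementsAt n (TimeChange.ofImg C g.1) f := fun g => by
    obtain ⟨n, hn⟩ := (isVeelike_iff _).1 g.2
    exact ⟨n, hn, exists_implementsAt hX n _⟩
  have hbij : ∀ (g g' : veelikeGroup A) (n n' : ℕ) (f f' : MappingTorus X → MappingTorus X),
      g' * g = 1 → ActsByPrefix n g.1 → ActsByPrefix n' g'.1 →
      ImplementsAt n (TimeChange.ofImg C g.1) f → ImplementsAt n' (TimeChange.ofImg C g'.1) f' →
      Function.Bijective (f' ∘ f) := by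
    intro g g' n n' f f' h1 hg hg' hf hf'
    obtain ⟨N, hN, hN'⟩ := exists_length_le g (max n n')
    have h := hf'.comp hX hf hg hg' ((le_max_left _ _).trans hN) fun w hw =>
      (le_max_right _ _).trans (hN' w hw)
    have hid : g'.1 ∘ g.1 = id := by
      have := congrArg (fun g : veelikeGroup A => (g.1 : List A → List A)) h1
      exact this
    generalize (TimeChange.ofImg C g'.1).comp (TimeChange.ofImg C g.1) hg hg' = Ψ at h
    revert h Ψ
    rw [hid]
    exact fun Ψ h => h.bijective
  obtain ⟨n, hg, f, hc, hf⟩ := key g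
  obtain ⟨n', hg', f', -, hf'⟩ := key g⁻¹
  have h1 := hbij g g⁻¹ n n' f f' (inv_mul_cancel g) hg hg' hf hf'
  have h2 := hbij g⁻¹ g n' n f' f (mul_inv_cancel g) hg' hg hf' hf
  obtain ⟨F, hF⟩ := exists_flowGroup hX hc
    ⟨h1.injective.of_comp, h2.surjective.of_comp⟩ hf
  exact ⟨F, n, hg, _, fun z hz h h' s => (hF _).trans (hf z hz h h' s)⟩

theorem Implements.mk_eq_one (hX : C.Stable X.carrier) {F : flowGroup X}
    (h : Implements C F (1 : veelikeGroup A).1) : ((isotopyCon X).mk' F : MCG X) = 1 := by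
  obtain ⟨n, -, Φ, hΦ⟩ := h
  exact ((isotopyCon X).eq.2 (ImplementsAt.isotopic_one hX (Φ := Φ) hΦ)).symm

end SymbolicMCG

/-! ### The embedding -/

theorem mainTheorem5 {A B : Type*} [Finite A] [Finite B] [TopologicalSpace B] [DiscreteTopology B]
    (X : SymbolicDynamics.FullShift.Subshift B ℤ)
    (hsofic : SymbolicMCG.IsSofic X) (hent : 0 < SymbolicMCG.entropy X) :
    ∃ φ : SymbolicMCG.veelikeGroup A →* SymbolicMCG.MCG X, Function.Injective φ := by
  obtain ⟨C, hX, hper⟩ := SymbolicMCG.exists_coding (A := A) X hsofic hent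
  choose F hF using SymbolicMCG.exists_implements hX
  let q := (SymbolicMCG.isotopyCon X).mk'
  have hinv : ∀ g, q (F g) * q (F g⁻¹) = 1 := fun g => by
    rw [← map_mul]
    refine SymbolicMCG.Implements.mk_eq_one hX ?_
    rw [← mul_inv_cancel g]
    exact (hF g).mul hX (hF g⁻¹)
  -- The chosen `F` are unrelated to one another. Multiplying by the class chosen for `(g * h)⁻¹`
  -- reduces the claim to a product that realizes the identity.
  have hmul : ∀ g h, q (F (g * h)) = q (F g) * q (F h) := fun g h => by
    rw [← mul_left_inj (q (F (g * h)⁻¹)), hinv, ← map_mul, ← map_mul]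
    refine (SymbolicMCG.Implements.mk_eq_one hX ?_).symm
    rw [← mul_inv_cancel (g * h)]
    exact ((hF g).mul hX (hF h)).mul hX (hF (g * h)⁻¹)
  refine ⟨MonoidHom.mk' (fun g => q (F g)) hmul, (injective_iff_map_eq_one _).2 fun g hg => ?_⟩
  refine (hF g).eq_one hX hper fun y => ?_
  have h1 : SymbolicMCG.Isotopic 1 (F g) := (SymbolicMCG.isotopyCon X).eq.1
    (show q 1 = q (F g) from (map_one q).trans hg.symm)
  exact SymbolicMCG.MappingTorus.exists_flow_of_isotopic h1 y
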